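/- **Setting.** Let $\mu$ be a probability measure on $[-1,1]$, let $\mathbb P_X$ be a probability measure on $[-1,1]^d$, and let $\tau_0\in\mathbb R$, $\theta_0\in\mathbb R^d$. For each $n$ let $A_n$ be a real symmetric $n\times n$ matrix. For treatments $t\in\{\pm1\}^n$ and covariates $x\in([-1,1]^d)^n$ (regarded as an $n\times d$ matrix with rows $x_1,\dots,x_n$), let $\langle Y_i\rangle_{t,x}$ be the mean of $y_i$ under the probability measure on $[-1,1]^n$ proportional to $$\exp\Big(\tfrac12 y^\top A_n y+y^\top(\tau_0 t+x\theta_0)\Big)\prod_{i=1}^n d\mu(y_i),$$ and let $m_i(t)=\mathbb E_X\langle Y_i\rangle_{t,X}$, where $X=(X_1,\dots,X_n)$ has i.i.d. rows $X_i\sim\mathbb P_X$. The average direct and indirect effects (for the uniform allocation) are $$\mathrm{DE}=\frac1n\sum_{i=1}^n\ \sum_{t_{-i}\in\{\pm1\}^{n-1}}2^{-(n-1)}\big(m_i(1,t_{-i})-m_i(-1,t_{-i})\big),$$ $$\mathrm{IE}=\frac1n\sum_{i=1}^n\ \sum_{t_{-i}\in\{\pm1\}^{n-1}}2^{-(n-1)}\big(m_i(-1,t_{-i})-m_i(-\mathbf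 1)\big),$$ where $(c,t_{-i})$ is the treatment vector with $i$-th entry $c$ and other entries $t_{-i}$. **Estimates.** Let $\alpha(\lambda)=\log\int e^{\lambda x}\,d\mu(x)$, and apply $\alpha'$ coordinatewise to vectors. Draw $\bar T$ uniformly from $\{\pm1\}^n$ and, independently, $\bar X=(\bar X_1,\dots,\bar X_n)$ with $\bar X_i$ i.i.d. from $\mathbb P_X$. Put $u^{(0)}=\tilde u^{(0)}=0$ and $$u^{(\ell+1)}=\alpha'\big(A_nu^{(\ell)}+\tau_0\bar T+\bar X\theta_0\big),\qquad \tilde u^{(\ell+1)}=\alpha'\big(A_n\tilde u^{(\ell)}-\tau_0\mathbf 1+\bar X\theta_0\big),$$ $$\widehat{\mathrm{DE}}_M=\frac2n\sum_{i=1}^n\bar T_iu_i^{(M)},\qquad \widehat{\mathrm{IE}}_M=\frac1n\Big(\sum_{i=1}^nu_i^{(M)}-\sum_{i=1}^n\tilde u_i^{(M)}\Big)-\frac12\widehat{\mathrm{DE}}_M.$$ Let $\widehat{\mathrm{DE}}_M^{\mathrm{avg}}$ and $\widehat{\mathrm{IE}}_M^{\mathrm{avg}}$ be the averages of these estimates over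 $k$ i.i.d. replicates of $(\bar T,\bar X)$. **Claim.** There is a universal constant $C_0>0$ (not depending on $d,\mu,\mathbb P_X,\tau_0,\theta_0$ or $(A_n)$) such that, whenever $\sup_n\|A_n\|<\infty$, $\mathrm{Tr}(A_n^2)=o(n)$ and $\limsup_{n\to\infty}\|A_n\|\le C_0$ ($\|\cdot\|$ denoting the Euclidean operator norm), for every $\varepsilon>0$ $$\lim_{k\to\infty}\limsup_{M\to\infty}\limsup_{n\to\infty}\mathbb P\Big[\big|\widehat{\mathrm{DE}}_M^{\mathrm{avg}}-\mathrm{DE}\big|>\varepsilon\Big]=0,$$ $$\lim_{k\to\infty}\limsup_{M\to\infty}\limsup_{n\to\infty}\mathbb P\Big[\big|\widehat{\mathrm{IE}}_M^{\mathrm{avg}}-\mathrm{IE}\big|>\varepsilon\Big]=0.$$ -/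

import Mathlib

open MeasureTheory ProbabilityTheory Filter Topology Asymptotics
open scoped Matrix ENNReal

namespace CausalMRF

noncomputable section

/-! ### The outcome regression model

Treatments take values in the two-element group of integer units, that is, in the set with the two
elements 1 and -1. Covariate profiles are `x : Fin n → Fin d → ℝ`, the `i`-th row being the
covariate vector of unit `i`. -/

/-- The vector `τ t + x θ`. -/
def extField {n d : ℕ} (τ : ℝ) (θ : Fin d → ℝ) (t : Fin n → ℤˣ) (x : Fin n → Fin d → ℝ) :
    Fin n → ℝ :=
  fun i => τ * ((t i : ℤ) : ℝ) + x i ⬝ᵥ θ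

/-- The law of the outcome vector given treatments `t` and covariates `x`: the probability measure
whose density with respect to the product measure `μ^n` is
`y ↦ exp (yᵀ A y / 2 + yᵀ (τ t + x θ)) / Z`, with `Z` the normalizing constant. -/
def gibbs {n d : ℕ} (μ : Measure ℝ) (A : Matrix (Fin n) (Fin n) ℝ) (τ : ℝ) (θ : Fin d → ℝ)
    (t : Fin n → ℤˣ) (x : Fin n → Fin d → ℝ) : Measure (Fin n → ℝ) :=
  (Measure.pi fun _ : Fin n => μ).tilted fun y =>
    (1 / 2 : ℝ) * (y ⬝ᵥ (A *ᵥ y)) + y ⬝ᵥ extField τ θ t x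

/-- The conditional mean of the outcome of unit `i` given `t` and `x`. -/
def gibbsMean {n d : ℕ} (μ : Measure ℝ) (A : Matrix (Fin n) (Fin n) ℝ) (τ : ℝ) (θ : Fin d → ℝ)
    (t : Fin n → ℤˣ) (x : Fin n → Fin d → ℝ) (i : Fin n) : ℝ :=
  ∫ y, y i ∂(gibbs μ A τ θ t x)

/-- The mean of the potential outcome of unit `i` under the treatment profile `t`: the conditional
mean given the covariates, averaged over i.i.d. covariates with law `PX`. -/
def meanOutcome {n d : ℕ} (μ : Measure ℝ) (PX : Measure (Fin d → ℝ))
    (A : Matrix (Fin n) (Fin n) ℝ) (τ : ℝ) (θ : Fin d → ℝ) (t : Fin n → ℤˣ) (i : Fin n) : ℝ :=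
  ∫ x, gibbsMean μ A τ θ t x i ∂(Measure.pi fun _ : Fin n => PX)

/-! ### The causal estimands -/

/-- The treatment profile in which unit `i` receives `c` and the other units receive `s`. -/
def setTreatment {n : ℕ} (i : Fin n) (c : ℤˣ) (s : {j : Fin n // j ≠ i} → ℤˣ) : Fin n → ℤˣ :=
  fun j => if h : j = i then c else s ⟨j, h⟩

/-- The direct effect for unit `i` when the other units receive `s`. -/
def unitDE {n d : ℕ} (μ : Measure ℝ) (PX : Measure (Fin d → ℝ)) (A : Matrix (Fin n) (Fin n) ℝ)
    (τ : ℝ) (θ : Fin d → ℝ) (i : Fin n) (s : {j : Fin n // j ≠ i} → ℤˣ) : ℝ :=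
  meanOutcome μ PX A τ θ (setTreatment i 1 s) i - meanOutcome μ PX A τ θ (setTreatment i (-1) s) i

/-- The indirect effect for unit `i` when the other units receive `s`. -/
def unitIE {n d : ℕ} (μ : Measure ℝ) (PX : Measure (Fin d → ℝ)) (A : Matrix (Fin n) (Fin n) ℝ)
    (τ : ℝ) (θ : Fin d → ℝ) (i : Fin n) (s : {j : Fin n // j ≠ i} → ℤˣ) : ℝ :=
  meanOutcome μ PX A τ θ (setTreatment i (-1) s) i - meanOutcome μ PX A τ θ (fun _ => -1) i

/-- The average direct effect, for the uniform allocation on the treatments of the other units. -/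
def DE {n d : ℕ} (μ : Measure ℝ) (PX : Measure (Fin d → ℝ)) (A : Matrix (Fin n) (Fin n) ℝ)
    (τ : ℝ) (θ : Fin d → ℝ) : ℝ :=
  (1 / (n : ℝ)) * ∑ i : Fin n, ∑ s : {j : Fin n // j ≠ i} → ℤˣ,
    (1 / 2 : ℝ) ^ (n - 1) * unitDE μ PX A τ θ i s

/-- The average indirect effect, for the uniform allocation on the treatments of the other
units. -/
def IE {n d : ℕ} (μ : Measure ℝ) (PX : Measure (Fin d → ℝ)) (A : Matrix (Fin n) (Fin n) ℝ)
    (τ : ℝ) (θ : Fin d → ℝ) : ℝ :=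
  (1 / (n : ℝ)) * ∑ i : Fin n, ∑ s : {j : Fin n // j ≠ i} → ℤˣ,
    (1 / 2 : ℝ) ^ (n - 1) * unitIE μ PX A τ θ i s

/-! ### The algorithm -/

/-- The log-normalizer `log ∫ exp (l₁ x + l₂ x² / 2) dμ(x)` of the quadratic exponential tilt. -/
def alpha (μ : Measure ℝ) (l₁ l₂ : ℝ) : ℝ :=
  Real.log (∫ x, Real.exp (l₁ * x + l₂ / 2 * x ^ 2) ∂μ)

/-- The derivative of `alpha` in its first argument. -/
def alphaDeriv (μ : Measure ℝ) (l₁ l₂ : ℝ) : ℝ :=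
  deriv (fun s => alpha μ s l₂) l₁

/-- The iterates started at zero of `u ↦ α'(A u + h, 0)`, applied coordinatewise. -/
def iterate {n : ℕ} (μ : Measure ℝ) (A : Matrix (Fin n) (Fin n) ℝ) (h : Fin n → ℝ) :
    ℕ → Fin n → ℝ
  | 0 => 0
  | l + 1 => fun i => alphaDeriv μ ((A *ᵥ iterate μ A h l) i + h i) 0

/-- The estimate of the direct effect after `M` iterations, from the simulated pair
`z = (treatments, covariates)`. -/
def estDE {n d : ℕ} (μ : Measure ℝ) (A : Matrix (Fin n) (Fin n) ℝ) (τ : ℝ) (θ : Fin d → ℝ)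
    (M : ℕ) (z : (Fin n → ℤˣ) × (Fin n → Fin d → ℝ)) : ℝ :=
  (2 / (n : ℝ)) * ∑ i, ((z.1 i : ℤ) : ℝ) * iterate μ A (extField τ θ z.1 z.2) M i

/-- The estimate of the indirect effect after `M` iterations, from the simulated pair
`z = (treatments, covariates)`. -/
def estIE {n d : ℕ} (μ : Measure ℝ) (A : Matrix (Fin n) (Fin n) ℝ) (τ : ℝ) (θ : Fin d → ℝ)
    (M : ℕ) (z : (Fin n → ℤˣ) × (Fin n → Fin d → ℝ)) : ℝ :=
  (1 / (n : ℝ)) * (∑ i, iterate μ A (extField τ θ z.1 z.2) M i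
      - ∑ i, iterate μ A (extField τ θ (fun _ => -1) z.2) M i)
    - (1 / 2) * estDE μ A τ θ M z

/-! ### Monte Carlo replicates -/

/-- The joint law of one simulated pair: treatments uniform on all `2 ^ n` profiles, and,
independently, i.i.d. covariates with law `PX`. -/
def simLaw {d : ℕ} (n : ℕ) (PX : Measure (Fin d → ℝ)) :
    Measure ((Fin n → ℤˣ) × (Fin n → Fin d → ℝ)) :=
  (PMF.uniformOfFintype (Fin n → ℤˣ)).toMeasure.prod (Measure.pi fun _ : Fin n => PX)

/-- The joint law of `k` independent simulated pairs. -/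
def replicateLaw {d : ℕ} (n k : ℕ) (PX : Measure (Fin d → ℝ)) :
    Measure (Fin k → (Fin n → ℤˣ) × (Fin n → Fin d → ℝ)) :=
  Measure.pi fun _ : Fin k => simLaw n PX

/-- The average of the estimates of the direct effect over `k` replicates. -/
def avgDE {n d k : ℕ} (μ : Measure ℝ) (A : Matrix (Fin n) (Fin n) ℝ) (τ : ℝ) (θ : Fin d → ℝ)
    (M : ℕ) (ω : Fin k → (Fin n → ℤˣ) × (Fin n → Fin d → ℝ)) : ℝ :=
  (1 / (k : ℝ)) * ∑ j, estDE μ A τ θ M (ω j)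

/-- The average of the estimates of the indirect effect over `k` replicates. -/
def avgIE {n d k : ℕ} (μ : Measure ℝ) (A : Matrix (Fin n) (Fin n) ℝ) (τ : ℝ) (θ : Fin d → ℝ)
    (M : ℕ) (ω : Fin k → (Fin n → ℤˣ) × (Fin n → Fin d → ℝ)) : ℝ :=
  (1 / (k : ℝ)) * ∑ j, estIE μ A τ θ M (ω j)

/-- The operator norm of a matrix with respect to the Euclidean norm. -/
def opNorm {n : ℕ} (A : Matrix (Fin n) (Fin n) ℝ) : ℝ :=
  ‖Matrix.toEuclideanCLM (n := Fin n) (𝕜 := ℝ) A‖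

end

end CausalMRF

namespace CausalMRF

/-! ### One-dimensional exponential tilts -/

/-! Both estimands are expectations, over a simulated pair (t, x), of a linear functional of the
Gibbs mean vectors; the estimates apply the same functional to the iterates. The functional is
bounded in the normalized ℓ² norm, so the bias is controlled once the iterates are close to the
Gibbs means in mean square, uniformly in the external field h. Averaging k replicates then costs a
variance O(1/k), handled by Chebyshev's inequality (`measure_pi_lt_abs_avg_sub_le`).

The core is the mean-square bound `sum_sq_integral_sub_iterate_le`, with error O(Tr A²) + O(n
2^(-l)). Under the Gibbs measure the conditional law of y_i given the rest is a quadratic tilt of μ.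
The residual r_i = y_i - E[y_i | others] is orthogonal to every function free of y_i. Since the
conditional mean of y_j changes by O(|A_ij|) when y_i is altered, E[r_i r_j] = O(|A_ij|) off the
diagonal, whence E|A r|² = O(Tr A²).

Thus, although y is not near a fixed point of y ↦ α'(A y + h), A y is nearly A α'(A y + h). The map
α' is 4-Lipschitz for every μ on [-1,1], so ‖A‖ ≤ 1/8 makes the iteration contract and forces A
u^(l) near A y. Consequently the conditional means, whose expectations are the Gibbs means, are near
α'(A u^(l) + h) = u^(l+1). The law of the covariates and the sizes of τ, θ enter only through h, so
the constant is universal. -/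

theorem ae_abs_le_one {μ : Measure ℝ} (h : ∀ᵐ y ∂μ, y ∈ Set.Icc (-1 : ℝ) 1) :
    ∀ᵐ y ∂μ, |y| ≤ 1 := by
  filter_upwards [h] with y hy using abs_le.2 hy

theorem abs_integral_le_of_ae_bound {Ω : Type*} [MeasurableSpace Ω] {ν : Measure Ω}
    [IsProbabilityMeasure ν] {f : Ω → ℝ} {c : ℝ} (h : ∀ᵐ x ∂ν, |f x| ≤ c) :
    |∫ x, f x ∂ν| ≤ c := by
  simpa using norm_integral_le_of_norm_le_const (μ := ν) (f := f) (C := c) h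

theorem integrable_exp_of_ae_bound {Ω : Type*} [MeasurableSpace Ω] {ν : Measure Ω}
    [IsFiniteMeasure ν] {f : Ω → ℝ} {c : ℝ} (hf : AEMeasurable f ν) (h : ∀ᵐ x ∂ν, |f x| ≤ c) :
    Integrable (fun x => Real.exp (f x)) ν := by
  refine Integrable.of_bound (hf.exp.aestronglyMeasurable) (Real.exp c) ?_
  filter_upwards [h] with x hx
  rw [Real.norm_eq_abs, Real.abs_exp]
  exact Real.exp_le_exp.2 (le_trans (le_abs_self _) hx)

theorem abs_integral_id_tilted_sub_le {ν : Measure ℝ} [IsProbabilityMeasure ν]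
    (hν : ∀ᵐ x ∂ν, |x| ≤ 1) {k : ℝ → ℝ} {δ : ℝ} (hk : AEMeasurable k ν)
    (hδ : ∀ᵐ x ∂ν, |k x| ≤ δ) :
    |∫ x, x ∂(ν.tilted k) - ∫ x, x ∂ν| ≤ 4 * δ := by
  have hint := integrable_exp_of_ae_bound hk hδ
  have := isProbabilityMeasure_tilted hint
  have hν' : ∀ᵐ x ∂(ν.tilted k), |x| ≤ 1 := (tilted_absolutelyContinuous ν k) hν
  -- For large δ the bound is trivial, both means lying in [-1,1]. Otherwise the log-density k - log
  -- Z is at most 2δ ≤ 1 in absolute value, where |e^s - 1| ≤ 2|s| applies.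
  by_cases hd : 1 / 2 ≤ δ
  · have h1 := abs_integral_le_of_ae_bound hν
    have h2 := abs_integral_le_of_ae_bound hν'
    calc _ ≤ |∫ x, x ∂(ν.tilted k)| + |∫ x, x ∂ν| := abs_sub _ _
      _ ≤ 4 * δ := by linarith
  push Not at hd
  set Z := ∫ x, Real.exp (k x) ∂ν with hZ
  have hZ0 : 0 < Z := integral_exp_pos hint
  have hid : Integrable (fun x : ℝ => x) ν := Integrable.of_bound (by fun_prop) 1 hν
  have hZu : Real.log Z ≤ δ := by
    rw [Real.log_le_iff_le_exp hZ0]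
    calc Z ≤ ∫ _, Real.exp δ ∂ν := integral_mono_ae hint (integrable_const _) (by
          filter_upwards [hδ] with x hx using Real.exp_le_exp.2 (abs_le.1 hx).2)
      _ = _ := by simp
  have hZl : -δ ≤ Real.log Z := by
    rw [Real.le_log_iff_exp_le hZ0]
    calc Real.exp (-δ) = ∫ _, Real.exp (-δ) ∂ν := by simp
      _ ≤ Z := integral_mono_ae (integrable_const _) hint (by
          filter_upwards [hδ] with x hx using Real.exp_le_exp.2 (abs_le.1 hx).1)
  have hb : ∀ᵐ x ∂ν, |Real.exp (k x) / Z - 1| ≤ 4 * δ := by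
    filter_upwards [hδ] with x hx
    have hx' := abs_le.1 hx
    have h1 : |k x - Real.log Z| ≤ 2 * δ := abs_le.2 ⟨by linarith, by linarith⟩
    have h2 := Real.abs_exp_sub_one_le (h1.trans (by linarith))
    rw [Real.exp_sub, Real.exp_log hZ0] at h2
    linarith
  have hint2 : Integrable (fun x => (Real.exp (k x) / Z) • x) ν := by
    simpa only [smul_eq_mul] using (hint.div_const Z).mul_bdd (c := 1) (by fun_prop) hν
  rw [integral_tilted, ← hZ, ← integral_sub hint2 hid]
  refine abs_integral_le_of_ae_bound ?_
  filter_upwards [hb, hν] with x h1 h2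
  have : (Real.exp (k x) / Z) • x - x = (Real.exp (k x) / Z - 1) * x := by
    simp [sub_mul]
  rw [this, abs_mul]
  calc _ ≤ 4 * δ * 1 := by gcongr; exact (abs_nonneg _).trans h1
    _ = _ := mul_one _

/-- The mean of the tilt of `μ` by `x ↦ l₁ x + l₂ x² / 2`. -/
noncomputable def quadMean (μ : Measure ℝ) (l₁ l₂ : ℝ) : ℝ :=
  ∫ x, x ∂(μ.tilted fun x => l₁ * x + l₂ / 2 * x ^ 2)

theorem abs_quad_le {l₁ l₂ x : ℝ} (hx : |x| ≤ 1) :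
    |l₁ * x + l₂ / 2 * x ^ 2| ≤ |l₁| + |l₂| := by
  have hx2 : |x| ^ 2 ≤ 1 := pow_le_one₀ (abs_nonneg _) hx
  calc _ ≤ |l₁ * x| + |l₂ / 2 * x ^ 2| := abs_add_le _ _
    _ = |l₁| * |x| + |l₂| * (|x| ^ 2 / 2) := by
        rw [abs_mul, abs_mul, abs_pow, abs_div]; norm_num; ring
    _ ≤ |l₁| * 1 + |l₂| * 1 := by gcongr; linarith
    _ = _ := by ring

section
variable {μ : Measure ℝ} [IsProbabilityMeasure μ]

theorem integrable_exp_quad (hμ : ∀ᵐ x ∂μ, |x| ≤ 1) (l₁ l₂ : ℝ) :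
    Integrable (fun x => Real.exp (l₁ * x + l₂ / 2 * x ^ 2)) μ := by
  refine integrable_exp_of_ae_bound (c := |l₁| + |l₂|) (by fun_prop) ?_
  filter_upwards [hμ] with x hx using abs_quad_le hx

/-- Changing the parameters is a further tilt of the already tilted measure, by an exponent of size
at most |l₁ - l₁'| + |l₂ - l₂'|. The Lipschitz constant 4 therefore does not depend on μ or on the
base point. -/
theorem abs_quadMean_sub_le (hμ : ∀ᵐ x ∂μ, |x| ≤ 1) (l₁ l₂ l₁' l₂' : ℝ) :
    |quadMean μ l₁ l₂ - quadMean μ l₁' l₂'| ≤ 4 * (|l₁ - l₁'| + |l₂ - l₂'|) := by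
  have hint := integrable_exp_quad hμ l₁' l₂'
  have := isProbabilityMeasure_tilted hint
  have h := abs_integral_id_tilted_sub_le
    (ν := μ.tilted fun x => l₁' * x + l₂' / 2 * x ^ 2)
    (k := fun x => (l₁ - l₁') * x + (l₂ - l₂') / 2 * x ^ 2)
    (δ := |l₁ - l₁'| + |l₂ - l₂'|)
    ((tilted_absolutelyContinuous μ _) hμ) (by fun_prop)
    ((tilted_absolutelyContinuous μ _) (by
      filter_upwards [hμ] with x hx using abs_quad_le hx))
  have he : ((fun x : ℝ => l₁' * x + l₂' / 2 * x ^ 2) +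
      fun x : ℝ => (l₁ - l₁') * x + (l₂ - l₂') / 2 * x ^ 2) =
      fun x => l₁ * x + l₂ / 2 * x ^ 2 := by
    ext x
    simp only [Pi.add_apply]
    ring
  rwa [tilted_tilted hint, he] at h

theorem abs_quadMean_le_one (hμ : ∀ᵐ x ∂μ, |x| ≤ 1) (l₁ l₂ : ℝ) : |quadMean μ l₁ l₂| ≤ 1 := by
  have := isProbabilityMeasure_tilted (integrable_exp_quad hμ l₁ l₂)
  exact abs_integral_le_of_ae_bound ((tilted_absolutelyContinuous μ _) hμ)

theorem continuous_quadMean (hμ : ∀ᵐ x ∂μ, |x| ≤ 1) (l₂ : ℝ) :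
    Continuous fun l => quadMean μ l l₂ := by
  refine (LipschitzWith.of_dist_le_mul (K := 4) fun a b => ?_).continuous
  simpa [Real.dist_eq] using abs_quadMean_sub_le hμ a l₂ b l₂

/-- The derivative of a cumulant generating function is the mean of the tilted law; bounded support
makes every exponential moment finite. -/
theorem alphaDeriv_zero_right (hμ : ∀ᵐ x ∂μ, |x| ≤ 1) (l : ℝ) :
    alphaDeriv μ l 0 = quadMean μ l 0 := by
  have hset : integrableExpSet (fun x : ℝ => x) μ = Set.univ := by
    ext t
    simpa [integrableExpSet] using integrable_exp_quad hμ t 0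
  have h := integral_tilted_mul_self (μ := μ) (X := fun x : ℝ => x) (t := l) (by simp [hset])
  unfold alphaDeriv quadMean alpha
  simp only [zero_div, zero_mul, add_zero]
  rw [h]
  rfl

theorem integral_exp_mul_sub_quadMean (hμ : ∀ᵐ x ∂μ, |x| ≤ 1) (l₁ l₂ : ℝ) :
    ∫ x, Real.exp (l₁ * x + l₂ / 2 * x ^ 2) * (x - quadMean μ l₁ l₂) ∂μ = 0 := by
  have hint := integrable_exp_quad hμ l₁ l₂
  have hpos := integral_exp_pos hint
  have hint2 : Integrable (fun x => Real.exp (l₁ * x + l₂ / 2 * x ^ 2) * x) μ :=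
    hint.mul_bdd (c := 1) (by fun_prop) hμ
  simp_rw [mul_sub]
  rw [integral_sub hint2 (hint.mul_const _), integral_mul_const]
  unfold quadMean
  rw [integral_tilted]
  simp only [smul_eq_mul, div_mul_eq_mul_div]
  simp only [div_mul_eq_mul_div] at hpos ⊢
  rw [integral_div, mul_div_cancel₀ _ hpos.ne', sub_self]

end

/-! ### Gibbs measures with an arbitrary external field -/

/-- The log-density `y ↦ yᵀ A y / 2 + yᵀ h`. -/
noncomputable def energy {n : ℕ} (A : Matrix (Fin n) (Fin n) ℝ) (h y : Fin n → ℝ) : ℝ :=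
  (1 / 2 : ℝ) * (y ⬝ᵥ (A *ᵥ y)) + y ⬝ᵥ h

/-- The Gibbs measure with couplings `A` and external field `h`. -/
noncomputable def fieldGibbs {n : ℕ} (μ : Measure ℝ) (A : Matrix (Fin n) (Fin n) ℝ)
    (h : Fin n → ℝ) : Measure (Fin n → ℝ) :=
  (Measure.pi fun _ : Fin n => μ).tilted (energy A h)

/-- The field acting on coordinate `i`, self-interaction excluded. -/
noncomputable def localField {n : ℕ} (A : Matrix (Fin n) (Fin n) ℝ) (h y : Fin n → ℝ)
    (i : Fin n) : ℝ :=
  (A *ᵥ y) i - A i i * y i + h i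

/-- The conditional mean of coordinate `i` under the Gibbs measure, given the others. -/
noncomputable def condMean {n : ℕ} (μ : Measure ℝ) (A : Matrix (Fin n) (Fin n) ℝ)
    (h y : Fin n → ℝ) (i : Fin n) : ℝ :=
  quadMean μ (localField A h y i) (A i i)

section
variable {n : ℕ} {μ : Measure ℝ} {A : Matrix (Fin n) (Fin n) ℝ} {h : Fin n → ℝ}

theorem update_eq_add_single (y : Fin n → ℝ) (i : Fin n) (x : ℝ) :
    Function.update y i x = Function.update y i 0 + Pi.single i x := by
  ext j
  by_cases hj : j = i
  · subst hj; simp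
  · simp [hj]

theorem mulVec_update (y : Fin n → ℝ) (i : Fin n) (x : ℝ) (j : Fin n) :
    (A *ᵥ Function.update y i x) j = (A *ᵥ Function.update y i 0) j + A j i * x := by
  rw [update_eq_add_single, Matrix.mulVec_add, Pi.add_apply]
  simp

theorem mulVec_update_sub (y : Fin n → ℝ) (i : Fin n) (x : ℝ) (j : Fin n) :
    (A *ᵥ Function.update y i x) j = (A *ᵥ y) j - A j i * y i + A j i * x := by
  have h1 := mulVec_update (A := A) y i (y i) j
  rw [Function.update_eq_self] at h1
  rw [mulVec_update, h1]
  ring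

theorem localField_update_self (y : Fin n → ℝ) (i : Fin n) (x : ℝ) :
    localField A h (Function.update y i x) i = localField A h y i := by
  unfold localField
  rw [mulVec_update_sub]
  simp

theorem condMean_update_self (y : Fin n → ℝ) (i : Fin n) (x : ℝ) :
    condMean μ A h (Function.update y i x) i = condMean μ A h y i := by
  rw [condMean, localField_update_self, condMean]

/-- As a function of one coordinate the energy is quadratic, which identifies the conditional law as
a quadratic tilt of μ. Symmetry merges the two cross terms into `localField`. -/
theorem energy_update (hA : A.IsSymm) (y : Fin n → ℝ) (i : Fin n) (x : ℝ) :
    energy A h (Function.update y i x) = energy A h (Function.update y i 0) +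
      (localField A h y i * x + A i i / 2 * x ^ 2) := by
  have h1 := mulVec_update_sub (A := A) y i 0 i
  set z := Function.update y i 0 with hz
  have hsym : z ⬝ᵥ A *ᵥ (Pi.single i x) = x * (A *ᵥ z) i := by
    rw [Matrix.dotProduct_mulVec, ← Matrix.mulVec_transpose, hA.eq, dotProduct_comm,
      single_dotProduct]
  have h2 : Function.update y i x = z + Pi.single i x := update_eq_add_single y i x
  unfold energy localField
  rw [h2, Matrix.mulVec_add, dotProduct_add, add_dotProduct, add_dotProduct, add_dotProduct, hsym,
    single_dotProduct, single_dotProduct, single_dotProduct, h1]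
  simp
  ring

theorem continuous_energy : Continuous (energy A h) := by
  unfold energy
  fun_prop

theorem continuous_localField (i : Fin n) : Continuous fun y => localField A h y i := by
  unfold localField
  have : Continuous fun y : Fin n → ℝ => (A *ᵥ y) i := by
    simp only [Matrix.mulVec, dotProduct]
    fun_prop
  fun_prop

variable [IsProbabilityMeasure μ]

theorem ae_pi_abs_le_one (hμ : ∀ᵐ x ∂μ, |x| ≤ 1) :
    ∀ᵐ y ∂(Measure.pi fun _ : Fin n => μ), ∀ i, |y i| ≤ 1 := by
  rw [ae_all_iff]
  exact fun i => (measurePreserving_eval (fun _ : Fin n => μ) i).quasiMeasurePreserving.ae hμ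

/-- The product measure is carried by a compact cube; integrability of continuous functions under
the Gibbs measure follows from this. -/
theorem exists_ae_bound_of_continuous (hμ : ∀ᵐ x ∂μ, |x| ≤ 1) {F : (Fin n → ℝ) → ℝ}
    (hF : Continuous F) : ∃ c, ∀ᵐ y ∂(Measure.pi fun _ : Fin n => μ), |F y| ≤ c := by
  have hK : IsCompact (Set.univ.pi fun _ : Fin n => Set.Icc (-1 : ℝ) 1) :=
    isCompact_univ_pi fun _ => isCompact_Icc
  obtain ⟨c, hc⟩ := hK.exists_bound_of_continuousOn hF.continuousOn
  refine ⟨c, ?_⟩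
  filter_upwards [ae_pi_abs_le_one hμ] with y hy
  exact hc y fun i _ => abs_le.1 (hy i)

theorem integrable_exp_energy (hμ : ∀ᵐ x ∂μ, |x| ≤ 1) (A : Matrix (Fin n) (Fin n) ℝ)
    (h : Fin n → ℝ) :
    Integrable (fun y => Real.exp (energy A h y)) (Measure.pi fun _ : Fin n => μ) := by
  obtain ⟨c, hc⟩ := exists_ae_bound_of_continuous hμ (continuous_energy (A := A) (h := h))
  exact integrable_exp_of_ae_bound continuous_energy.aemeasurable hc

theorem isProbabilityMeasure_fieldGibbs (hμ : ∀ᵐ x ∂μ, |x| ≤ 1)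
    (A : Matrix (Fin n) (Fin n) ℝ) (h : Fin n → ℝ) :
    IsProbabilityMeasure (fieldGibbs μ A h) :=
  isProbabilityMeasure_tilted (integrable_exp_energy hμ A h)

theorem ae_fieldGibbs_abs_le_one (hμ : ∀ᵐ x ∂μ, |x| ≤ 1) (A : Matrix (Fin n) (Fin n) ℝ)
    (h : Fin n → ℝ) :
    ∀ᵐ y ∂(fieldGibbs μ A h), ∀ i, |y i| ≤ 1 :=
  (tilted_absolutelyContinuous _ _) (ae_pi_abs_le_one hμ)

theorem integrable_fieldGibbs (hμ : ∀ᵐ x ∂μ, |x| ≤ 1) {F : (Fin n → ℝ) → ℝ}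
    (hF : Continuous F) : Integrable F (fieldGibbs μ A h) := by
  have := isProbabilityMeasure_fieldGibbs hμ A h
  obtain ⟨c, hc⟩ := exists_ae_bound_of_continuous hμ hF
  exact Integrable.of_bound hF.aestronglyMeasurable c ((tilted_absolutelyContinuous _ _) hc)

theorem measurable_update_prod (i : Fin n) :
    Measurable fun p : (Fin n → ℝ) × ℝ => Function.update p.1 i p.2 := by
  rw [measurable_pi_iff]
  intro j
  by_cases hj : j = i
  · subst hj; simpa using measurable_snd
  · simp only [Function.update_of_ne hj]
    exact (measurable_pi_apply j).comp measurable_fst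

/-- Resampling one coordinate independently preserves the product measure. This gives access to
Fubini in coordinate i without splitting the index type. -/
theorem map_update_pi_prod (μ : Measure ℝ) [IsProbabilityMeasure μ] (i : Fin n) :
    ((Measure.pi fun _ : Fin n => μ).prod μ).map (fun p => Function.update p.1 i p.2) =
      Measure.pi fun _ : Fin n => μ := by
  have hm := measurable_update_prod i
  refine (Measure.pi_eq fun s hs => ?_).symm
  have hpre : (fun p : (Fin n → ℝ) × ℝ => Function.update p.1 i p.2) ⁻¹' (Set.univ.pi s) =
      (Set.univ.pi (Function.update s i Set.univ)) ×ˢ (s i) := by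
    ext p
    simp only [Set.mem_preimage, Set.mem_pi, Set.mem_univ, true_implies, Set.mem_prod]
    constructor
    · intro hp
      refine ⟨fun j => ?_, by simpa using hp i⟩
      by_cases hj : j = i
      · subst hj; simp
      · simpa [hj] using hp j
    · rintro ⟨hp, hi⟩ j
      by_cases hj : j = i
      · subst hj; simpa using hi
      · simpa [hj] using hp j
  rw [Measure.map_apply hm (MeasurableSet.univ_pi hs), hpre, Measure.prod_prod, Measure.pi_pi,
    ← Finset.mul_prod_erase _ _ (Finset.mem_univ i),
    ← Finset.mul_prod_erase _ (fun j => μ (s j)) (Finset.mem_univ i)]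
  simp only [Function.update_self, measure_univ, one_mul]
  rw [mul_comm]
  congr 1
  refine Finset.prod_congr rfl fun j hj => ?_
  rw [Function.update_of_ne (Finset.ne_of_mem_erase hj)]

theorem continuous_condMean (hμ : ∀ᵐ x ∂μ, |x| ≤ 1) (i : Fin n) :
    Continuous fun y => condMean μ A h y i :=
  (continuous_quadMean hμ (A i i)).comp (continuous_localField i)

/-- Resample coordinate i and integrate it first: g and the remaining energy factor out, and the
inner integral is that of a centred variable under its tilt. This is the orthogonality defining a
conditional expectation. -/
theorem integral_sub_condMean_mul (hμ : ∀ᵐ x ∂μ, |x| ≤ 1) (hA : A.IsSymm) (i : Fin n)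
    {g : (Fin n → ℝ) → ℝ} (hg : Continuous g)
    (hgi : ∀ y x, g (Function.update y i x) = g y) :
    ∫ y, (y i - condMean μ A h y i) * g y ∂(fieldGibbs μ A h) = 0 := by
  set π := Measure.pi fun _ : Fin n => μ with hπ
  set Φ : (Fin n → ℝ) → ℝ := fun y =>
    Real.exp (energy A h y) * ((y i - condMean μ A h y i) * g y) with hΦ
  have hc := continuous_condMean (A := A) (h := h) hμ i
  have hΦc : Continuous Φ := by
    have := continuous_energy (A := A) (h := h)
    fun_prop
  have hΦi : Integrable Φ π := by
    obtain ⟨c, hc⟩ := exists_ae_bound_of_continuous hμ hΦc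
    exact Integrable.of_bound hΦc.aestronglyMeasurable c hc
  have hmap := map_update_pi_prod (n := n) μ i
  rw [← hπ] at hmap
  have hm := measurable_update_prod i
  have hzero : ∫ y, Φ y ∂π = 0 := by
    have hi2 : Integrable (fun p : (Fin n → ℝ) × ℝ => Φ (Function.update p.1 i p.2))
        (π.prod μ) := by
      refine Integrable.comp_measurable (g := Φ) ?_ hm
      rw [hmap]; exact hΦi
    rw [← hmap, integral_map hm.aemeasurable hΦc.aestronglyMeasurable, integral_prod _ hi2]
    refine integral_eq_zero_of_ae (Eventually.of_forall fun y => ?_)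
    have : ∀ x, Φ (Function.update y i x) =
        (Real.exp (energy A h (Function.update y i 0)) * g y) *
        (Real.exp (localField A h y i * x + A i i / 2 * x ^ 2) *
          (x - quadMean μ (localField A h y i) (A i i))) := by
      intro x
      simp only [hΦ]
      rw [energy_update hA, Real.exp_add, condMean_update_self, hgi, Function.update_self,
        condMean]
      ring
    simp only [this]
    rw [integral_const_mul, integral_exp_mul_sub_quadMean hμ, mul_zero]
    rfl
  rw [fieldGibbs, integral_tilted]
  have : ∀ y, (Real.exp (energy A h y) / ∫ x, Real.exp (energy A h x) ∂π) •
      ((y i - condMean μ A h y i) * g y) = Φ y / ∫ x, Real.exp (energy A h x) ∂π := by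
    intro y
    simp only [hΦ, smul_eq_mul]
    ring
  simp only [← hπ, this]
  rw [integral_div, hzero, zero_div]

end

/-! ### Matrix norms -/

section
variable {n : ℕ} {A : Matrix (Fin n) (Fin n) ℝ}

theorem sum_sq_mulVec_le (A : Matrix (Fin n) (Fin n) ℝ) (v : Fin n → ℝ) :
    ∑ i, (A *ᵥ v) i ^ 2 ≤ opNorm A ^ 2 * ∑ i, v i ^ 2 := by
  have h := (Matrix.toEuclideanCLM (n := Fin n) (𝕜 := ℝ) A).le_opNorm (WithLp.toLp 2 v)
  rw [Matrix.toEuclideanCLM_toLp] at h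
  have h2 := pow_le_pow_left₀ (norm_nonneg _) h 2
  rw [mul_pow, EuclideanSpace.norm_sq_eq, EuclideanSpace.norm_sq_eq] at h2
  simpa [opNorm] using h2

theorem sum_sq_mulVec_le_of_opNorm_le (hA : opNorm A ≤ 1 / 8) (v : Fin n → ℝ) :
    ∑ i, (A *ᵥ v) i ^ 2 ≤ 1 / 64 * ∑ i, v i ^ 2 := by
  refine (sum_sq_mulVec_le A v).trans ?_
  have h0 : 0 ≤ opNorm A := norm_nonneg _
  have : opNorm A ^ 2 ≤ 1 / 64 := by
    calc _ ≤ (1 / 8 : ℝ) ^ 2 := pow_le_pow_left₀ h0 hA 2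
      _ = _ := by norm_num
  exact mul_le_mul_of_nonneg_right this (Finset.sum_nonneg fun i _ => sq_nonneg _)

theorem trace_mul_self_eq_sum_sq (hA : A.IsSymm) : (A * A).trace = ∑ i, ∑ j, A i j ^ 2 := by
  simp only [Matrix.trace, Matrix.diag, Matrix.mul_apply]
  refine Finset.sum_congr rfl fun i _ => Finset.sum_congr rfl fun j _ => ?_
  rw [hA.apply i j, sq]

/-- The columns of A² are A applied to the columns of A. -/
theorem sum_sq_mul_self_le (hA : opNorm A ≤ 1 / 8) :
    ∑ i, ∑ j, (A * A) i j ^ 2 ≤ 1 / 64 * ∑ i, ∑ j, A i j ^ 2 := by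
  rw [Finset.sum_comm, Finset.sum_comm (f := fun i j => A i j ^ 2), Finset.mul_sum]
  refine Finset.sum_le_sum fun j _ => ?_
  exact sum_sq_mulVec_le_of_opNorm_le hA fun i => A i j

theorem sum_sq_diag_le (A : Matrix (Fin n) (Fin n) ℝ) :
    ∑ i, A i i ^ 2 ≤ ∑ i, ∑ j, A i j ^ 2 :=
  Finset.sum_le_sum fun i _ =>
    Finset.single_le_sum (f := fun j => A i j ^ 2) (fun _ _ => sq_nonneg _) (Finset.mem_univ i)

end

theorem integral_sum_sum_const_mul {Ω ι : Type*} [Fintype ι] [MeasurableSpace Ω] {ν : Measure Ω}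
    (c : ι → ι → ℝ) {f : ι → ι → Ω → ℝ} (hf : ∀ i j, Integrable (f i j) ν) :
    ∫ y, ∑ i, ∑ j, c i j * f i j y ∂ν = ∑ i, ∑ j, c i j * ∫ y, f i j y ∂ν := by
  rw [integral_finsetSum _ fun i _ => integrable_finsetSum _ fun j _ => (hf i j).const_mul _]
  refine Finset.sum_congr rfl fun i _ => ?_
  rw [integral_finsetSum _ fun j _ => (hf i j).const_mul _]
  exact Finset.sum_congr rfl fun j _ => integral_const_mul _ _

/-! ### Residuals of the conditional means -/

section
variable {n : ℕ} {μ : Measure ℝ} [IsProbabilityMeasure μ] {A : Matrix (Fin n) (Fin n) ℝ}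

/-- The residual of `y` with respect to its conditional means. -/
noncomputable def residual (μ : Measure ℝ) (A : Matrix (Fin n) (Fin n) ℝ) (h y : Fin n → ℝ) :
    Fin n → ℝ :=
  fun i => y i - condMean μ A h y i

theorem continuous_residual (hμ : ∀ᵐ x ∂μ, |x| ≤ 1) (h : Fin n → ℝ) (i : Fin n) :
    Continuous fun y => residual μ A h y i :=
  (continuous_apply i).sub (continuous_condMean hμ i)

theorem abs_residual_le (hμ : ∀ᵐ x ∂μ, |x| ≤ 1) {h y : Fin n → ℝ} {i : Fin n} (hy : |y i| ≤ 1) :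
    |residual μ A h y i| ≤ 2 := by
  have h1 : |condMean μ A h y i| ≤ 1 := abs_quadMean_le_one hμ _ _
  calc _ ≤ |y i| + |condMean μ A h y i| := abs_sub _ _
    _ ≤ 2 := by linarith

theorem abs_condMean_update_sub_le (hμ : ∀ᵐ x ∂μ, |x| ≤ 1) (h : Fin n → ℝ) {y : Fin n → ℝ}
    {i j : Fin n} (hij : i ≠ j) (hy : |y i| ≤ 1) :
    |condMean μ A h (Function.update y i 0) j - condMean μ A h y j| ≤ 4 * |A j i| := by
  refine (abs_quadMean_sub_le hμ _ _ _ _).trans ?_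
  have : localField A h (Function.update y i 0) j - localField A h y j = -(A j i * y i) := by
    unfold localField
    rw [mulVec_update_sub, Function.update_of_ne hij.symm]
    ring
  rw [this, sub_self, abs_zero, add_zero, abs_neg, abs_mul]
  have := mul_le_mul_of_nonneg_left hy (abs_nonneg (A j i))
  linarith

/-- Off the diagonal, r_i is orthogonal to y_j - b_j, where b_j is the conditional mean of y_j
evaluated with y_i set to 0. So r_j may be replaced by b_j minus the true conditional mean, which is
at most 4|A_ij|, while |r_i| ≤ 2. On the diagonal the trivial bound 4 suffices. -/
theorem abs_integral_residual_mul_le (hμ : ∀ᵐ x ∂μ, |x| ≤ 1) (hA : A.IsSymm) (h : Fin n → ℝ)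
    (i j : Fin n) :
    |∫ y, residual μ A h y i * residual μ A h y j ∂(fieldGibbs μ A h)| ≤
      8 * |A i j| + if i = j then 4 else 0 := by
  have := isProbabilityMeasure_fieldGibbs hμ A h
  have hae := ae_fieldGibbs_abs_le_one hμ A h
  split_ifs with hij
  · subst hij
    have : |∫ y, residual μ A h y i * residual μ A h y i ∂(fieldGibbs μ A h)| ≤ 4 := by
      refine abs_integral_le_of_ae_bound ?_
      filter_upwards [hae] with y hy
      rw [abs_mul]
      have h1 := abs_residual_le (A := A) (h := h) hμ (hy i)
      calc _ ≤ (2 : ℝ) * 2 := by gcongr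
        _ = 4 := by norm_num
    have h0 := abs_nonneg (A i i)
    linarith
  · have hupd : Continuous fun y : Fin n → ℝ => Function.update y i (0 : ℝ) := by fun_prop
    have hbc : Continuous fun y : Fin n → ℝ => condMean μ A h (Function.update y i 0) j :=
      (continuous_condMean hμ j).comp hupd
    have hz := integral_sub_condMean_mul (h := h) hμ hA i
      (g := fun y => y j - condMean μ A h (Function.update y i 0) j) (by fun_prop) (by
        intro y x
        rw [Function.update_of_ne (Ne.symm hij), Function.update_idem])
    have hri := continuous_residual (A := A) hμ h i
    have hrj := continuous_residual (A := A) hμ h j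
    have e : ∫ y, residual μ A h y i * residual μ A h y j ∂(fieldGibbs μ A h) =
        ∫ y, residual μ A h y i *
          (condMean μ A h (Function.update y i 0) j - condMean μ A h y j) ∂(fieldGibbs μ A h) := by
      rw [← sub_eq_zero, ← integral_sub]
      · refine Eq.trans ?_ hz
        refine integral_congr_ae (Eventually.of_forall fun y => ?_)
        simp only [residual]
        ring
      · exact integrable_fieldGibbs hμ (hri.mul hrj)
      · exact integrable_fieldGibbs hμ (hri.mul (hbc.sub (continuous_condMean hμ j)))
    rw [e, add_zero]
    refine abs_integral_le_of_ae_bound ?_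
    filter_upwards [hae] with y hy
    rw [abs_mul]
    have h1 := abs_residual_le (A := A) (h := h) hμ (hy i)
    have h2 := abs_condMean_update_sub_le (A := A) hμ h hij (hy i)
    rw [hA.apply i j] at h2
    calc _ ≤ 2 * (4 * |A i j|) := by gcongr
      _ = _ := by ring

theorem continuous_mulVec_residual (hμ : ∀ᵐ x ∂μ, |x| ≤ 1) (h : Fin n → ℝ) (k : Fin n) :
    Continuous fun y => (A *ᵥ residual μ A h y) k := by
  simp only [Matrix.mulVec, dotProduct]
  exact continuous_finsetSum _ fun i _ => continuous_const.mul (continuous_residual hμ h i)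

theorem integral_sum_sq_mulVec_residual_le (hμ : ∀ᵐ x ∂μ, |x| ≤ 1) (hA : A.IsSymm)
    (hA' : opNorm A ≤ 1 / 8) (h : Fin n → ℝ) :
    ∫ y, ∑ k, (A *ᵥ residual μ A h y) k ^ 2 ∂(fieldGibbs μ A h) ≤ 9 * (A * A).trace := by
  set F := (A * A).trace with hF
  have hFs : F = ∑ i, ∑ j, A i j ^ 2 := trace_mul_self_eq_sum_sq hA
  set E : Fin n → Fin n → ℝ :=
    fun i j => ∫ y, residual μ A h y i * residual μ A h y j ∂(fieldGibbs μ A h) with hE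
  have hint : ∀ i j, Integrable (fun y => residual μ A h y i * residual μ A h y j)
      (fieldGibbs μ A h) := fun i j =>
    integrable_fieldGibbs hμ ((continuous_residual hμ h i).mul (continuous_residual hμ h j))
  have hpt : ∀ y, ∑ k, (A *ᵥ residual μ A h y) k ^ 2 =
      ∑ i, ∑ j, (A * A) i j * (residual μ A h y i * residual μ A h y j) := by
    intro y
    have h1 : ∀ k, (A *ᵥ residual μ A h y) k ^ 2 =
        ∑ i, ∑ j, A i k * A k j * (residual μ A h y i * residual μ A h y j) := by
      intro k
      simp only [Matrix.mulVec, dotProduct]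
      rw [sq, Finset.sum_mul_sum]
      refine Finset.sum_congr rfl fun i _ => Finset.sum_congr rfl fun j _ => ?_
      rw [hA.apply k i]
      ring
    simp only [h1, Matrix.mul_apply, Finset.sum_mul]
    rw [Finset.sum_comm]
    refine Finset.sum_congr rfl fun i _ => Finset.sum_comm
  have hexp : ∫ y, ∑ k, (A *ᵥ residual μ A h y) k ^ 2 ∂(fieldGibbs μ A h) =
      ∑ i, ∑ j, (A * A) i j * E i j := by
    simp only [hpt]
    exact integral_sum_sum_const_mul (fun i j => (A * A) i j) hint
  have hdiag : ∀ i, (A * A) i i = ∑ j, A i j ^ 2 := by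
    intro i
    rw [Matrix.mul_apply]
    exact Finset.sum_congr rfl fun j _ => by rw [hA.apply i j, sq]
  -- AM-GM turns 8ab into 4a² + 4b². The diagonal entries of A² are nonnegative, so their
  -- contribution sums to 4 Tr A² without absolute values.
  have hb : ∀ i j, (A * A) i j * E i j ≤
      4 * (A * A) i j ^ 2 + 4 * A i j ^ 2 + if i = j then 4 * (A * A) i j else 0 := by
    intro i j
    have h1 := abs_integral_residual_mul_le hμ hA h i j
    have h2 : (A * A) i j * E i j ≤
        |(A * A) i j| * (8 * |A i j| + if i = j then 4 else 0) :=
      (le_abs_self _).trans (by rw [abs_mul]; gcongr)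
    have h3 := two_mul_le_add_sq |(A * A) i j| |A i j|
    rw [sq_abs, sq_abs] at h3
    split_ifs at h2 ⊢ with hij
    · subst hij
      have : |(A * A) i i| = (A * A) i i := abs_of_nonneg (by
        rw [hdiag]; exact Finset.sum_nonneg fun _ _ => sq_nonneg _)
      rw [this] at h2 h3
      linarith
    · linarith
  rw [hexp]
  calc ∑ i, ∑ j, (A * A) i j * E i j
      ≤ ∑ i, ∑ j, (4 * (A * A) i j ^ 2 + 4 * A i j ^ 2 +
          if i = j then 4 * (A * A) i j else 0) :=
        Finset.sum_le_sum fun i _ => Finset.sum_le_sum fun j _ => hb i j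
    _ = 4 * ∑ i, ∑ j, (A * A) i j ^ 2 + 4 * F + 4 * F := by
        simp only [Finset.sum_add_distrib, Finset.sum_ite_eq, Finset.mem_univ, if_true,
          ← Finset.mul_sum]
        rw [← hFs]
        rfl
    _ ≤ 9 * F := by
        have h1 := sum_sq_mul_self_le hA'
        rw [← hFs] at h1
        have h2 : 0 ≤ F := by
          rw [hFs]; exact Finset.sum_nonneg fun _ _ => Finset.sum_nonneg fun _ _ => sq_nonneg _
        linarith

end

/-! ### Comparison of the iterates with the Gibbs means -/

theorem sq_integral_le_integral_sq {Ω : Type*} [MeasurableSpace Ω] {ν : Measure Ω}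
    [IsProbabilityMeasure ν] {f : Ω → ℝ} (hf : MemLp f 2 ν) :
    (∫ x, f x ∂ν) ^ 2 ≤ ∫ x, f x ^ 2 ∂ν := by
  have h := variance_nonneg f ν
  rw [variance_eq_sub hf] at h
  simpa using h

theorem sum_sq_add_le {ι : Type*} [Fintype ι] (f g : ι → ℝ) :
    ∑ i, (f i + g i) ^ 2 ≤ 2 * ∑ i, f i ^ 2 + 2 * ∑ i, g i ^ 2 := by
  rw [Finset.mul_sum, Finset.mul_sum, ← Finset.sum_add_distrib]
  refine Finset.sum_le_sum fun i _ => ?_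
  nlinarith [sq_nonneg (f i - g i)]

section
variable {n : ℕ} {μ : Measure ℝ} [IsProbabilityMeasure μ] {A : Matrix (Fin n) (Fin n) ℝ}

/-- The map `y ↦ α'(A y + h)`, applied coordinatewise. -/
noncomputable def meanFieldMap (μ : Measure ℝ) (A : Matrix (Fin n) (Fin n) ℝ) (h y : Fin n → ℝ) :
    Fin n → ℝ :=
  fun i => quadMean μ ((A *ᵥ y) i + h i) 0

theorem iterate_succ (hμ : ∀ᵐ x ∂μ, |x| ≤ 1) (h : Fin n → ℝ) (l : ℕ) :
    iterate μ A h (l + 1) = meanFieldMap μ A h (iterate μ A h l) := by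
  ext i
  simp only [iterate, meanFieldMap]
  exact alphaDeriv_zero_right hμ _

theorem abs_iterate_le_one (hμ : ∀ᵐ x ∂μ, |x| ≤ 1) (h : Fin n → ℝ) (l : ℕ) (i : Fin n) :
    |iterate μ A h l i| ≤ 1 := by
  cases l with
  | zero => simp [iterate]
  | succ l => rw [iterate_succ hμ]; exact abs_quadMean_le_one hμ _ _

theorem sum_sq_meanFieldMap_sub_le (hμ : ∀ᵐ x ∂μ, |x| ≤ 1) (h y z : Fin n → ℝ) :
    ∑ i, (meanFieldMap μ A h y i - meanFieldMap μ A h z i) ^ 2 ≤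
      16 * ∑ i, (A *ᵥ (y - z)) i ^ 2 := by
  rw [Finset.mul_sum]
  refine Finset.sum_le_sum fun i _ => ?_
  have h1 := abs_quadMean_sub_le hμ ((A *ᵥ y) i + h i) 0 ((A *ᵥ z) i + h i) 0
  have h2 : (A *ᵥ (y - z)) i = (A *ᵥ y) i + h i - ((A *ᵥ z) i + h i) := by
    rw [Matrix.mulVec_sub, Pi.sub_apply]; ring
  rw [sub_self, abs_zero, add_zero, ← h2] at h1
  have h3 := pow_le_pow_left₀ (abs_nonneg _) h1 2
  rw [sq_abs, mul_pow, sq_abs] at h3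
  unfold meanFieldMap
  linarith

/-- Ignoring self-interaction shifts the linear parameter by at most |A_ii| and the quadratic one by
|A_ii|, hence the factor (4 · 2)² = 64. -/
theorem sum_sq_condMean_sub_le (hμ : ∀ᵐ x ∂μ, |x| ≤ 1) (h : Fin n → ℝ) {y : Fin n → ℝ}
    (hy : ∀ i, |y i| ≤ 1) :
    ∑ i, (condMean μ A h y i - meanFieldMap μ A h y i) ^ 2 ≤ 64 * ∑ i, A i i ^ 2 := by
  rw [Finset.mul_sum]
  refine Finset.sum_le_sum fun i _ => ?_
  have h1 := abs_quadMean_sub_le hμ (localField A h y i) (A i i) ((A *ᵥ y) i + h i) 0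
  have h2 : localField A h y i - ((A *ᵥ y) i + h i) = -(A i i * y i) := by
    unfold localField; ring
  rw [h2, abs_neg, abs_mul, sub_zero] at h1
  have h4 := mul_le_mul_of_nonneg_left (hy i) (abs_nonneg (A i i))
  have h5 : |condMean μ A h y i - meanFieldMap μ A h y i| ≤ 8 * |A i i| := by
    unfold condMean meanFieldMap
    linarith
  have h3 := pow_le_pow_left₀ (abs_nonneg _) h5 2
  rw [sq_abs, mul_pow, sq_abs] at h3
  linarith

/-- One step multiplies the squared distance by at most 2 · (1/64) · 16 = 1/2 and adds twice the
fixed-point defect; the coefficient 4 solves c = 2 + c/2. The distance is measured after applying A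
because only A(y - α'(A y + h)) is small. -/
theorem sum_sq_mulVec_sub_iterate_le (hμ : ∀ᵐ x ∂μ, |x| ≤ 1) (hA' : opNorm A ≤ 1 / 8)
    (h y : Fin n → ℝ) (l : ℕ) :
    ∑ i, (A *ᵥ (y - iterate μ A h l)) i ^ 2 ≤
      4 * ∑ i, (A *ᵥ (y - meanFieldMap μ A h y)) i ^ 2 +
        (1 / 2) ^ l * ∑ i, (A *ᵥ y) i ^ 2 := by
  have hP : 0 ≤ ∑ i, (A *ᵥ (y - meanFieldMap μ A h y)) i ^ 2 :=
    Finset.sum_nonneg fun _ _ => sq_nonneg _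
  induction l with
  | zero =>
    have : iterate μ A h 0 = 0 := rfl
    rw [this, sub_zero, pow_zero]
    linarith
  | succ l ih =>
    rw [iterate_succ hμ]
    set u := iterate μ A h l
    have hsplit : y - meanFieldMap μ A h u =
        (y - meanFieldMap μ A h y) + (meanFieldMap μ A h y - meanFieldMap μ A h u) := by abel
    have h1 := sum_sq_add_le (A *ᵥ (y - meanFieldMap μ A h y))
      (A *ᵥ (meanFieldMap μ A h y - meanFieldMap μ A h u))
    have h2 := sum_sq_mulVec_le_of_opNorm_le hA' (meanFieldMap μ A h y - meanFieldMap μ A h u)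
    have h3 := sum_sq_meanFieldMap_sub_le (A := A) hμ h y u
    simp only [Pi.sub_apply] at h2
    rw [hsplit, Matrix.mulVec_add]
    simp only [Pi.add_apply]
    rw [pow_succ]
    linarith

theorem sum_sq_condMean_sub_iterate_le (hμ : ∀ᵐ x ∂μ, |x| ≤ 1) (hA : A.IsSymm)
    (hA' : opNorm A ≤ 1 / 8) (h : Fin n → ℝ) {y : Fin n → ℝ} (hy : ∀ i, |y i| ≤ 1) (l : ℕ) :
    ∑ i, (condMean μ A h y i - iterate μ A h (l + 1) i) ^ 2 ≤
      384 * (A * A).trace + 256 * ∑ i, (A *ᵥ residual μ A h y) i ^ 2 +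
        32 * (1 / 2) ^ l * n := by
  have hF := sum_sq_diag_le A
  rw [← trace_mul_self_eq_sum_sq hA] at hF
  set c := meanFieldMap μ A h y with hc
  have h1 := sum_sq_add_le (fun i => condMean μ A h y i - c i)
    (fun i => c i - iterate μ A h (l + 1) i)
  simp only [sub_add_sub_cancel] at h1
  have h2 := sum_sq_condMean_sub_le (A := A) hμ h hy
  have h3 := sum_sq_meanFieldMap_sub_le (A := A) hμ h y (iterate μ A h l)
  rw [← iterate_succ hμ] at h3
  have h4 := sum_sq_mulVec_sub_iterate_le hμ hA' h y l
  have h5 := sum_sq_add_le (A *ᵥ residual μ A h y) (A *ᵥ fun i => condMean μ A h y i - c i)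
  have h6 : y - c = residual μ A h y + fun i => condMean μ A h y i - c i := by
    ext i
    simp [residual]
  have h7 := sum_sq_mulVec_le_of_opNorm_le hA' fun i => condMean μ A h y i - c i
  have h8 : ∑ i, (A *ᵥ y) i ^ 2 ≤ n := by
    refine (sum_sq_mulVec_le_of_opNorm_le hA' y).trans ?_
    have : ∑ i, y i ^ 2 ≤ ∑ _i : Fin n, (1 : ℝ) :=
      Finset.sum_le_sum fun i _ => by rw [← sq_abs]; exact pow_le_one₀ (abs_nonneg _) (hy i)
    simp only [Finset.sum_const, Finset.card_univ, Fintype.card_fin, nsmul_eq_mul, mul_one] at this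
    have h0 : (0 : ℝ) ≤ n := Nat.cast_nonneg n
    linarith
  have h9 : (1 / 2 : ℝ) ^ l * ∑ i, (A *ᵥ y) i ^ 2 ≤ (1 / 2) ^ l * n := by gcongr
  rw [← hc, h6, Matrix.mulVec_add] at h4
  simp only [Pi.add_apply] at h4
  rw [← hc] at h2 h3
  linarith

theorem integral_apply_fieldGibbs (hμ : ∀ᵐ x ∂μ, |x| ≤ 1) (hA : A.IsSymm) (h : Fin n → ℝ)
    (i : Fin n) :
    ∫ y, y i ∂(fieldGibbs μ A h) = ∫ y, condMean μ A h y i ∂(fieldGibbs μ A h) := by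
  have h1 := integral_sub_condMean_mul (h := h) hμ hA i (g := fun _ => 1) continuous_const
    fun _ _ => rfl
  simp only [mul_one] at h1
  rw [integral_sub (integrable_fieldGibbs hμ (continuous_apply i))
    (integrable_fieldGibbs hμ (continuous_condMean hμ i))] at h1
  linarith

/-- At high temperature the iterates approximate the Gibbs means in mean square, uniformly in the
external field. -/
theorem sum_sq_integral_sub_iterate_le (hμ : ∀ᵐ x ∂μ, |x| ≤ 1) (hA : A.IsSymm)
    (hA' : opNorm A ≤ 1 / 8) (h : Fin n → ℝ) (l : ℕ) :
    ∑ i, (∫ y, y i ∂(fieldGibbs μ A h) - iterate μ A h (l + 1) i) ^ 2 ≤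
      2688 * (A * A).trace + 32 * (1 / 2) ^ l * n := by
  have := isProbabilityMeasure_fieldGibbs hμ A h
  set u := iterate μ A h (l + 1) with hu
  have hd : ∀ i, Continuous fun y => condMean μ A h y i - u i := fun i =>
    (continuous_condMean hμ i).sub continuous_const
  have hq : Continuous fun y => ∑ i, (A *ᵥ residual μ A h y) i ^ 2 :=
    continuous_finsetSum _ fun i _ => (continuous_mulVec_residual hμ h i).pow 2
  calc ∑ i, (∫ y, y i ∂(fieldGibbs μ A h) - u i) ^ 2
      ≤ ∑ i, ∫ y, (condMean μ A h y i - u i) ^ 2 ∂(fieldGibbs μ A h) := by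
        refine Finset.sum_le_sum fun i _ => ?_
        -- Replacing y_i by its conditional mean before Jensen is essential: the fluctuations of y_i
        -- itself need not be small.
        have e : ∫ y, y i ∂(fieldGibbs μ A h) - u i =
            ∫ y, (condMean μ A h y i - u i) ∂(fieldGibbs μ A h) := by
          rw [integral_sub (integrable_fieldGibbs hμ (continuous_condMean hμ i))
            (integrable_const _), integral_apply_fieldGibbs hμ hA]
          simp
        rw [e]
        obtain ⟨c, hc⟩ := exists_ae_bound_of_continuous hμ (hd i)
        exact sq_integral_le_integral_sq (MemLp.of_bound (hd i).aestronglyMeasurable c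
          ((tilted_absolutelyContinuous _ _) hc))
    _ = ∫ y, ∑ i, (condMean μ A h y i - u i) ^ 2 ∂(fieldGibbs μ A h) :=
        (integral_finsetSum _ fun i _ => integrable_fieldGibbs hμ ((hd i).pow 2)).symm
    _ ≤ ∫ y, (384 * (A * A).trace + 256 * ∑ i, (A *ᵥ residual μ A h y) i ^ 2 +
          32 * (1 / 2) ^ l * n) ∂(fieldGibbs μ A h) := by
        refine integral_mono_ae
          (integrable_fieldGibbs hμ (continuous_finsetSum _ fun i _ => (hd i).pow 2))
          (integrable_fieldGibbs hμ (by fun_prop)) ?_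
        filter_upwards [ae_fieldGibbs_abs_le_one hμ A h] with y hy
        exact sum_sq_condMean_sub_iterate_le hμ hA hA' h hy l
    _ = 384 * (A * A).trace + 256 * ∫ y, ∑ i, (A *ᵥ residual μ A h y) i ^ 2 ∂(fieldGibbs μ A h) +
          32 * (1 / 2) ^ l * n := by
        have hqi := integrable_fieldGibbs (A := A) (h := h) hμ hq
        have e : ∀ y, 384 * (A * A).trace + 256 * ∑ i, (A *ᵥ residual μ A h y) i ^ 2 +
            32 * (1 / 2) ^ l * (n : ℝ) = 256 * ∑ i, (A *ᵥ residual μ A h y) i ^ 2 +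
            (384 * (A * A).trace + 32 * (1 / 2) ^ l * n) := fun y => by ring
        simp only [e]
        rw [integral_add (hqi.const_mul _) (integrable_const _), integral_const_mul]
        simp only [integral_const, probReal_univ, one_smul]
        ring
    _ ≤ _ := by
        have h1 := integral_sum_sq_mulVec_residual_le hμ hA hA' h
        linarith

theorem abs_avg_mul_le {a v : Fin n → ℝ} (ha : ∀ i, |a i| ≤ 1) {R : ℝ} (hR : 0 ≤ R)
    (hv : ∑ i, v i ^ 2 ≤ n * R ^ 2) : |(1 / (n : ℝ)) * ∑ i, a i * v i| ≤ R := by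
  rcases Nat.eq_zero_or_pos n with rfl | hn
  · simpa using hR
  have hn' : (0 : ℝ) < n := by exact_mod_cast hn
  have h1 : (∑ i, a i * v i) ^ 2 ≤ (n * R) ^ 2 := by
    have h2 := Finset.sum_mul_sq_le_sq_mul_sq Finset.univ a v
    have h3 : ∑ i, a i ^ 2 ≤ ∑ _i : Fin n, (1 : ℝ) :=
      Finset.sum_le_sum fun i _ => by rw [← sq_abs]; exact pow_le_one₀ (abs_nonneg _) (ha i)
    simp only [Finset.sum_const, Finset.card_univ, Fintype.card_fin, nsmul_eq_mul, mul_one] at h3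
    calc _ ≤ _ := h2
      _ ≤ n * (n * R ^ 2) := mul_le_mul h3 hv (Finset.sum_nonneg fun _ _ => sq_nonneg _) hn'.le
      _ = _ := by ring
  have h4 := abs_le_of_sq_le_sq h1 (by positivity)
  rw [abs_mul, abs_of_pos (by positivity)]
  calc _ ≤ 1 / (n : ℝ) * (n * R) := by gcongr
    _ = R := by field_simp

end

/-! ### Averages over replicates -/

/-- Half of ε absorbs the bias; Chebyshev treats the other half, with variance at most B²/k. -/
theorem measure_pi_lt_abs_avg_sub_le {Ω : Type*} [MeasurableSpace Ω] (ρ : Measure Ω)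
    [IsProbabilityMeasure ρ] {f : Ω → ℝ} (hf : Measurable f) {B : ℝ} (hB : ∀ z, |f z| ≤ B)
    {m ε : ℝ} (hε : 0 < ε) (hm : |∫ z, f z ∂ρ - m| < ε / 2) {k : ℕ} (hk : 0 < k) :
    (Measure.pi fun _ : Fin k => ρ) {ω | ε < |(1 / (k : ℝ)) * ∑ j, f (ω j) - m|} ≤
      ENNReal.ofReal (4 * B ^ 2 / ε ^ 2 / k) := by
  have hk' : (0 : ℝ) < k := by exact_mod_cast hk
  have hL : MemLp f 2 ρ := MemLp.of_bound hf.aestronglyMeasurable B (Eventually.of_forall hB)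
  set P := Measure.pi fun _ : Fin k => ρ with hP
  set S : (Fin k → Ω) → ℝ := ∑ j, fun ω => f (ω j) with hS
  have hLj : ∀ j : Fin k, MemLp (fun ω : Fin k → Ω => f (ω j)) 2 P := fun j =>
    hL.comp_measurePreserving (measurePreserving_eval (fun _ : Fin k => ρ) j)
  have hX : MemLp S 2 P := memLp_finsetSum' _ fun j _ => hLj j
  have hvar : variance S P ≤ k * B ^ 2 := by
    have h1 := variance_sum_pi (μ := fun _ : Fin k => ρ) (X := fun _ => f) fun _ => hL
    rw [← hP, ← hS] at h1
    have h2 : variance f ρ ≤ B ^ 2 := by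
      have := variance_le_sq_of_bounded (X := f) (μ := ρ) (a := -B) (b := B)
        (Eventually.of_forall fun z => abs_le.1 (hB z)) hf.aemeasurable
      calc _ ≤ _ := this
        _ = B ^ 2 := by ring
    rw [h1, Finset.sum_const, Finset.card_univ, Fintype.card_fin, nsmul_eq_mul]
    gcongr
  have hmean : ∫ ω, S ω ∂P = k * ∫ z, f z ∂ρ := by
    simp only [hS, Finset.sum_apply]
    rw [integral_finsetSum _ fun j _ => (hLj j).integrable (by norm_num)]
    have : ∀ j : Fin k, ∫ ω, f (ω j) ∂P = ∫ z, f z ∂ρ := fun j => by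
      have hmp := measurePreserving_eval (fun _ : Fin k => ρ) j
      have h3 := integral_map (μ := P) hmp.measurable.aemeasurable
        (f := f) (by rw [hmp.map_eq]; exact hf.aestronglyMeasurable)
      rw [hmp.map_eq] at h3
      exact h3.symm
    simp [this]
  have hsub : {ω | ε < |(1 / (k : ℝ)) * ∑ j, f (ω j) - m|} ⊆
      {ω | k * (ε / 2) ≤ |S ω - ∫ ω, S ω ∂P|} := by
    intro ω hω
    simp only [Set.mem_ofPred_eq] at hω ⊢
    have hSω : S ω = ∑ j, f (ω j) := by simp [hS]
    have h1 : S ω - ∫ ω, S ω ∂P = k * ((1 / (k : ℝ)) * ∑ j, f (ω j) - ∫ z, f z ∂ρ) := by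
      rw [hmean, hSω]; field_simp
    rw [h1, abs_mul, abs_of_pos hk']
    have h2 := abs_sub_le ((1 / (k : ℝ)) * ∑ j, f (ω j)) (∫ z, f z ∂ρ) m
    gcongr
    linarith
  calc _ ≤ P {ω | k * (ε / 2) ≤ |S ω - ∫ ω, S ω ∂P|} := measure_mono hsub
    _ ≤ ENNReal.ofReal (variance S P / (k * (ε / 2)) ^ 2) :=
        meas_ge_le_variance_div_sq hX (by positivity)
    _ ≤ ENNReal.ofReal (k * B ^ 2 / (k * (ε / 2)) ^ 2) := by gcongr
    _ = _ := by congr 1; field_simp; ring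

/-! ### Effects as functionals of mean outcomes -/

section
variable {n : ℕ}

/-- The direct effect functional of treatments `t` and outcomes `v`. -/
noncomputable def directEffect (t : Fin n → ℤˣ) (v : Fin n → ℝ) : ℝ :=
  (2 / (n : ℝ)) * ∑ i, ((t i : ℤ) : ℝ) * v i

/-- The indirect effect functional of treatments `t`, outcomes `v`, and outcomes `w` under no
treatment. -/
noncomputable def indirectEffect (t : Fin n → ℤˣ) (v w : Fin n → ℝ) : ℝ :=
  (1 / (n : ℝ)) * (∑ i, v i - ∑ i, w i) - (1 / 2) * directEffect t v

theorem directEffect_sub (t : Fin n → ℤˣ) (v v' : Fin n → ℝ) :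
    directEffect t v - directEffect t v' = directEffect t (v - v') := by
  simp only [directEffect, Pi.sub_apply, mul_sub, Finset.sum_sub_distrib]

theorem indirectEffect_sub (t : Fin n → ℤˣ) (v w v' w' : Fin n → ℝ) :
    indirectEffect t v w - indirectEffect t v' w' = indirectEffect t (v - v') (w - w') := by
  simp only [indirectEffect, ← directEffect_sub, Pi.sub_apply, Finset.sum_sub_distrib]
  ring

theorem abs_directEffect_le (t : Fin n → ℤˣ) {v : Fin n → ℝ} {R : ℝ} (hR : 0 ≤ R)
    (hv : ∑ i, v i ^ 2 ≤ n * R ^ 2) : |directEffect t v| ≤ 2 * R := by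
  have ht : ∀ i, |((t i : ℤ) : ℝ)| ≤ 1 := fun i => by
    rcases Int.units_eq_one_or (t i) with h | h <;> simp [h]
  have h := abs_avg_mul_le ht hR hv
  have e : directEffect t v = 2 * ((1 / (n : ℝ)) * ∑ i, ((t i : ℤ) : ℝ) * v i) := by
    unfold directEffect; ring
  rw [e, abs_mul, abs_two]
  linarith

theorem abs_indirectEffect_le (t : Fin n → ℤˣ) {v w : Fin n → ℝ} {R : ℝ} (hR : 0 ≤ R)
    (hv : ∑ i, v i ^ 2 ≤ n * R ^ 2) (hw : ∑ i, w i ^ 2 ≤ n * R ^ 2) :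
    |indirectEffect t v w| ≤ 3 * R := by
  have h1 := abs_le.1 (abs_directEffect_le t hR hv)
  have h2 := abs_le.1 (abs_avg_mul_le (a := fun _ : Fin n => (1 : ℝ)) (by simp) hR hv)
  have h3 := abs_le.1 (abs_avg_mul_le (a := fun _ : Fin n => (1 : ℝ)) (by simp) hR hw)
  simp only [one_mul] at h2 h3
  unfold indirectEffect
  rw [mul_sub]
  exact abs_le.2 ⟨by linarith, by linarith⟩

theorem sum_sq_le_of_abs_le_one {v : Fin n → ℝ} (hv : ∀ i, |v i| ≤ 1) :
    ∑ i, v i ^ 2 ≤ n * (1 : ℝ) ^ 2 := by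
  have : ∑ i, v i ^ 2 ≤ ∑ _i : Fin n, (1 : ℝ) :=
    Finset.sum_le_sum fun i _ => by rw [← sq_abs]; exact pow_le_one₀ (abs_nonneg _) (hv i)
  simpa using this

/-! ### Sums over treatment profiles -/

theorem sum_treatments_eq (i : Fin n) (F : (Fin n → ℤˣ) → ℝ) :
    ∑ t, F t = ∑ s, F (setTreatment i 1 s) + ∑ s, F (setTreatment i (-1) s) := by
  have hsymm : ∀ c s, (Equiv.funSplitAt i ℤˣ).symm (c, s) = setTreatment i c s := by
    intro c s
    funext j
    by_cases hj : j = i <;> simp [setTreatment, hj]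
  rw [← (Equiv.funSplitAt i ℤˣ).symm.sum_comp, Fintype.sum_prod_type, UnitsInt.univ,
    Finset.sum_pair (by decide)]
  simp only [hsymm]

theorem sum_treatments_mul (i : Fin n) (F : (Fin n → ℤˣ) → ℝ) :
    ∑ t, ((t i : ℤ) : ℝ) * F t =
      ∑ s, F (setTreatment i 1 s) - ∑ s, F (setTreatment i (-1) s) := by
  rw [sum_treatments_eq i]
  simp [setTreatment, sub_eq_add_neg]

end

/-! ### Estimands and estimates in terms of the effect functionals -/

section
variable {n d : ℕ} (PX : Measure (Fin d → ℝ)) {μ : Measure ℝ} {A : Matrix (Fin n) (Fin n) ℝ}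

/-- The index i serves only to exclude n = 0, where truncated subtraction would break the identity.
-/
theorem half_pow_pred (i : Fin n) : (1 / 2 : ℝ) ^ (n - 1) = 2 * (1 / 2) ^ n := by
  obtain ⟨m, rfl⟩ : ∃ m, n = m + 1 := ⟨n - 1, by have := i.2; omega⟩
  rw [Nat.add_sub_cancel, pow_succ]
  ring

theorem DE_eq_sum_directEffect (τ : ℝ) (θ : Fin d → ℝ) :
    DE μ PX A τ θ = ∑ t, (1 / 2 : ℝ) ^ n * directEffect t (meanOutcome μ PX A τ θ t) := by
  unfold DE directEffect
  have h : ∀ i : Fin n, ∑ s : {j : Fin n // j ≠ i} → ℤˣ,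
      (1 / 2 : ℝ) ^ (n - 1) * unitDE μ PX A τ θ i s =
      2 * (1 / 2) ^ n * ∑ t : Fin n → ℤˣ, ((t i : ℤ) : ℝ) * meanOutcome μ PX A τ θ t i := by
    intro i
    rw [sum_treatments_mul i fun t => meanOutcome μ PX A τ θ t i, ← Finset.mul_sum,
      half_pow_pred i, ← Finset.sum_sub_distrib]
    rfl
  simp only [h]
  rw [← Finset.mul_sum, ← Finset.mul_sum, ← Finset.mul_sum, Finset.sum_comm]
  ring

/-- Averaging m_i(-1, ·) over the other units equals averaging (1 - t_i) m_i(t) over all profiles;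
the term t_i m_i(t) produces half the direct effect. -/
theorem IE_eq_sum_indirectEffect (τ : ℝ) (θ : Fin d → ℝ) :
    IE μ PX A τ θ = ∑ t, (1 / 2 : ℝ) ^ n *
      indirectEffect t (meanOutcome μ PX A τ θ t) (meanOutcome μ PX A τ θ fun _ => -1) := by
  set m := meanOutcome μ PX A τ θ with hm
  have h : ∀ i : Fin n, ∑ s : {j : Fin n // j ≠ i} → ℤˣ,
      (1 / 2 : ℝ) ^ (n - 1) * unitIE μ PX A τ θ i s =
      ∑ t : Fin n → ℤˣ, (1 / 2) ^ n *
        (m t i - m (fun _ => -1) i - ((t i : ℤ) : ℝ) * m t i) := by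
    intro i
    have hcard : (∑ _t : Fin n → ℤˣ, m (fun _ => -1) i) =
        2 * ∑ _s : {j : Fin n // j ≠ i} → ℤˣ, m (fun _ => -1) i := by
      rw [sum_treatments_eq i, two_mul]
    rw [← Finset.mul_sum, ← Finset.mul_sum, Finset.sum_sub_distrib, Finset.sum_sub_distrib,
      sum_treatments_mul i fun t => m t i, sum_treatments_eq i fun t => m t i, hcard,
      half_pow_pred i]
    unfold unitIE
    rw [Finset.sum_sub_distrib]
    ring
  unfold IE
  simp only [h]
  rw [Finset.sum_comm, Finset.mul_sum]
  refine Finset.sum_congr rfl fun t _ => ?_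
  unfold indirectEffect directEffect
  rw [← Finset.mul_sum, Finset.sum_sub_distrib, Finset.sum_sub_distrib]
  ring

theorem estDE_eq (τ : ℝ) (θ : Fin d → ℝ) (l : ℕ) (z : (Fin n → ℤˣ) × (Fin n → Fin d → ℝ)) :
    estDE μ A τ θ l z = directEffect z.1 (iterate μ A (extField τ θ z.1 z.2) l) :=
  rfl

theorem estIE_eq (τ : ℝ) (θ : Fin d → ℝ) (l : ℕ) (z : (Fin n → ℤˣ) × (Fin n → Fin d → ℝ)) :
    estIE μ A τ θ l z = indirectEffect z.1 (iterate μ A (extField τ θ z.1 z.2) l)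
      (iterate μ A (extField τ θ (fun _ => -1) z.2) l) :=
  rfl

end

/-! ### The law of a simulated pair -/

/-- Makes the finite space of treatment profiles discrete, so that measurability need only be
checked in the covariates and the uniform law integrates to a finite sum. -/
theorem measurableSingletonClass_intUnits : MeasurableSingletonClass ℤˣ :=
  ⟨fun u => ⟨{(u : ℤ)}, measurableSet_singleton _, by ext v; simp [Units.ext_iff]⟩⟩

attribute [local instance] measurableSingletonClass_intUnits

section
variable {n d : ℕ} (PX : Measure (Fin d → ℝ)) [IsProbabilityMeasure PX]

theorem isProbabilityMeasure_simLaw (n : ℕ) : IsProbabilityMeasure (simLaw n PX) := by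
  have := PMF.toMeasure.isProbabilityMeasure (PMF.uniformOfFintype (Fin n → ℤˣ))
  unfold simLaw
  infer_instance

theorem measurable_of_measurable_section {f : (Fin n → ℤˣ) × (Fin n → Fin d → ℝ) → ℝ}
    (hf : ∀ t, Measurable fun x => f (t, x)) : Measurable f :=
  measurable_from_prod_countable_right hf

theorem integral_simLaw {f : (Fin n → ℤˣ) × (Fin n → Fin d → ℝ) → ℝ}
    (hf : ∀ t, Measurable fun x => f (t, x)) {c : ℝ} (hc : ∀ z, |f z| ≤ c) :
    ∫ z, f z ∂(simLaw n PX) =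
      ∑ t, (1 / 2 : ℝ) ^ n * ∫ x, f (t, x) ∂(Measure.pi fun _ : Fin n => PX) := by
  have := PMF.toMeasure.isProbabilityMeasure (PMF.uniformOfFintype (Fin n → ℤˣ))
  unfold simLaw
  rw [integral_prod _ (Integrable.of_bound
    (measurable_of_measurable_section hf).aestronglyMeasurable c (Eventually.of_forall hc)),
    PMF.integral_eq_sum]
  simp

/-! ### Means of outcomes -/

variable {μ : Measure ℝ} [IsProbabilityMeasure μ] {A : Matrix (Fin n) (Fin n) ℝ}

theorem gibbsMean_eq_fieldGibbs (μ : Measure ℝ) (A : Matrix (Fin n) (Fin n) ℝ) (τ : ℝ)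
    (θ : Fin d → ℝ) (t : Fin n → ℤˣ) (x : Fin n → Fin d → ℝ) (i : Fin n) :
    gibbsMean μ A τ θ t x i = ∫ y, y i ∂(fieldGibbs μ A (extField τ θ t x)) :=
  rfl

theorem abs_gibbsMean_le_one (hμ : ∀ᵐ x ∂μ, |x| ≤ 1) (τ : ℝ)
    (θ : Fin d → ℝ) (t : Fin n → ℤˣ) (x : Fin n → Fin d → ℝ) (i : Fin n) :
    |gibbsMean μ A τ θ t x i| ≤ 1 := by
  have := isProbabilityMeasure_fieldGibbs hμ A (extField τ θ t x)
  rw [gibbsMean_eq_fieldGibbs]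
  refine abs_integral_le_of_ae_bound ?_
  filter_upwards [ae_fieldGibbs_abs_le_one hμ A (extField τ θ t x)] with y hy using hy i

theorem continuous_extField (τ : ℝ) (θ : Fin d → ℝ) (t : Fin n → ℤˣ) :
    Continuous fun x : Fin n → Fin d → ℝ => extField τ θ t x := by
  unfold extField
  refine continuous_pi fun i => ?_
  simp only [dotProduct]
  fun_prop

theorem measurable_gibbsMean (τ : ℝ) (θ : Fin d → ℝ) (t : Fin n → ℤˣ) (i : Fin n) :
    Measurable fun x => gibbsMean μ A τ θ t x i := by
  have hc := continuous_extField τ θ t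
  have he : Continuous fun p : (Fin n → Fin d → ℝ) × (Fin n → ℝ) =>
      Real.exp (energy A (extField τ θ t p.1) p.2) := by
    have : Continuous fun p : (Fin n → Fin d → ℝ) × (Fin n → ℝ) => extField τ θ t p.1 :=
      hc.comp continuous_fst
    unfold energy
    fun_prop
  have he2 : Continuous fun p : (Fin n → Fin d → ℝ) × (Fin n → ℝ) =>
      Real.exp (energy A (extField τ θ t p.1) p.2) * p.2 i := by fun_prop
  have h1 := (he.stronglyMeasurable.integral_prod_right'
    (ν := Measure.pi fun _ : Fin n => μ)).measurable
  have h2 := (he2.stronglyMeasurable.integral_prod_right'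
    (ν := Measure.pi fun _ : Fin n => μ)).measurable
  -- The Gibbs mean is a ratio of two parameter integrals of jointly continuous functions.
  convert h2.div h1 using 2 with x
  rw [gibbsMean_eq_fieldGibbs, fieldGibbs, integral_tilted]
  simp only [smul_eq_mul, div_mul_eq_mul_div]
  rw [integral_div]
  rfl

theorem measurable_iterate (hμ : ∀ᵐ x ∂μ, |x| ≤ 1) (l : ℕ) :
    Measurable fun h : Fin n → ℝ => iterate μ A h l := by
  induction l with
  | zero => exact measurable_const
  | succ l ih =>
    simp only [iterate_succ hμ]
    refine measurable_pi_lambda _ fun i => ?_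
    refine (continuous_quadMean hμ 0).measurable.comp (Measurable.add ?_ (measurable_pi_apply i))
    simp only [Matrix.mulVec, dotProduct]
    exact Finset.measurable_sum _ fun j _ =>
      measurable_const.mul ((measurable_pi_apply j).comp ih)

theorem measurable_directEffect {X : Type*} [MeasurableSpace X] (t : Fin n → ℤˣ)
    {v : X → Fin n → ℝ} (hv : ∀ i, Measurable fun x => v x i) :
    Measurable fun x => directEffect t (v x) := by
  unfold directEffect
  fun_prop

theorem measurable_indirectEffect {X : Type*} [MeasurableSpace X] (t : Fin n → ℤˣ)
    {v w : X → Fin n → ℝ} (hv : ∀ i, Measurable fun x => v x i)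
    (hw : ∀ i, Measurable fun x => w x i) :
    Measurable fun x => indirectEffect t (v x) (w x) := by
  have := measurable_directEffect t hv
  unfold indirectEffect
  fun_prop

theorem measurable_iterate_extField (hμ : ∀ᵐ x ∂μ, |x| ≤ 1) (τ : ℝ) (θ : Fin d → ℝ)
    (t : Fin n → ℤˣ) (l : ℕ) (i : Fin n) :
    Measurable fun x : Fin n → Fin d → ℝ => iterate μ A (extField τ θ t x) l i :=
  (measurable_pi_apply i).comp
    ((measurable_iterate hμ l).comp (continuous_extField τ θ t).measurable)

/-! ### The estimands as expectations -/

theorem integrable_gibbsMean (hμ : ∀ᵐ x ∂μ, |x| ≤ 1) (τ : ℝ) (θ : Fin d → ℝ) (t : Fin n → ℤˣ)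
    (i : Fin n) :
    Integrable (fun x => gibbsMean μ A τ θ t x i) (Measure.pi fun _ : Fin n => PX) :=
  Integrable.of_bound (measurable_gibbsMean τ θ t i).aestronglyMeasurable 1
    (Eventually.of_forall fun x => abs_gibbsMean_le_one hμ τ θ t x i)

theorem integral_directEffect_gibbsMean (hμ : ∀ᵐ x ∂μ, |x| ≤ 1) (τ : ℝ) (θ : Fin d → ℝ)
    (t : Fin n → ℤˣ) :
    ∫ x, directEffect t (gibbsMean μ A τ θ t x) ∂(Measure.pi fun _ : Fin n => PX) =
      directEffect t (meanOutcome μ PX A τ θ t) := by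
  unfold directEffect meanOutcome
  rw [integral_const_mul, integral_finsetSum _ fun i _ =>
    (integrable_gibbsMean PX hμ τ θ t i).const_mul _]
  simp only [integral_const_mul]

theorem integral_indirectEffect_gibbsMean (hμ : ∀ᵐ x ∂μ, |x| ≤ 1) (τ : ℝ) (θ : Fin d → ℝ)
    (t t' : Fin n → ℤˣ) :
    ∫ x, indirectEffect t (gibbsMean μ A τ θ t x) (gibbsMean μ A τ θ t' x)
        ∂(Measure.pi fun _ : Fin n => PX) =
      indirectEffect t (meanOutcome μ PX A τ θ t) (meanOutcome μ PX A τ θ t') := by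
  have hi := integrable_gibbsMean (A := A) PX hμ τ θ
  have h1 : ∀ t, Integrable (fun x => ∑ i, gibbsMean μ A τ θ t x i)
      (Measure.pi fun _ : Fin n => PX) := fun t => integrable_finsetSum _ fun i _ => hi t i
  have h2 : Integrable (fun x => directEffect t (gibbsMean μ A τ θ t x))
      (Measure.pi fun _ : Fin n => PX) := by
    unfold directEffect
    exact (integrable_finsetSum _ fun i _ => (hi t i).const_mul _).const_mul _
  unfold indirectEffect
  have h3 : Integrable (fun x => 1 / (n : ℝ) * (∑ i, gibbsMean μ A τ θ t x i -
      ∑ i, gibbsMean μ A τ θ t' x i)) (Measure.pi fun _ : Fin n => PX) :=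
    ((h1 t).sub (h1 t')).const_mul _
  rw [integral_sub h3 (h2.const_mul _), integral_const_mul, integral_const_mul,
    integral_directEffect_gibbsMean PX hμ, integral_sub (h1 t) (h1 t'),
    integral_finsetSum _ fun i _ => hi t i, integral_finsetSum _ fun i _ => hi t' i]
  rfl

/-! ### Bias of the estimates -/

/-- The squared root-mean-square error bound of the iterates. -/
noncomputable def meanSqError (A : Matrix (Fin n) (Fin n) ℝ) (l : ℕ) : ℝ :=
  2688 * ((A * A).trace / n) + 32 * (1 / 2) ^ l

theorem sum_sq_iterate_sub_gibbsMean_le (hμ : ∀ᵐ x ∂μ, |x| ≤ 1) (hA : A.IsSymm)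
    (hA' : opNorm A ≤ 1 / 8) (hn : 0 < n) {R : ℝ} {l : ℕ} (hR : meanSqError A l ≤ R ^ 2)
    (τ : ℝ) (θ : Fin d → ℝ) (t : Fin n → ℤˣ) (x : Fin n → Fin d → ℝ) :
    ∑ i, (iterate μ A (extField τ θ t x) (l + 1) - gibbsMean μ A τ θ t x) i ^ 2 ≤
      n * R ^ 2 := by
  have hn' : (0 : ℝ) < n := by exact_mod_cast hn
  have h := sum_sq_integral_sub_iterate_le hμ hA hA' (extField τ θ t x) l
  have e : n * meanSqError A l = 2688 * (A * A).trace + 32 * (1 / 2) ^ l * n := by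
    unfold meanSqError
    field_simp
  calc _ = ∑ i, (∫ y, y i ∂(fieldGibbs μ A (extField τ θ t x)) -
        iterate μ A (extField τ θ t x) (l + 1) i) ^ 2 := by
        refine Finset.sum_congr rfl fun i _ => ?_
        rw [Pi.sub_apply, gibbsMean_eq_fieldGibbs]
        ring
    _ ≤ n * meanSqError A l := by rw [e]; exact h
    _ ≤ n * R ^ 2 := by gcongr

variable (τ : ℝ) (θ : Fin d → ℝ) (l : ℕ)

/-- The bound 2 would hold; 3 is used so that both estimates share one constant. -/
theorem abs_estDE_le (hμ : ∀ᵐ x ∂μ, |x| ≤ 1) (z : (Fin n → ℤˣ) × (Fin n → Fin d → ℝ)) :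
    |estDE μ A τ θ l z| ≤ 3 := by
  have h := abs_directEffect_le z.1 zero_le_one
    (sum_sq_le_of_abs_le_one (abs_iterate_le_one (A := A) hμ (extField τ θ z.1 z.2) l))
  rw [estDE_eq]
  linarith

theorem abs_estIE_le (hμ : ∀ᵐ x ∂μ, |x| ≤ 1) (z : (Fin n → ℤˣ) × (Fin n → Fin d → ℝ)) :
    |estIE μ A τ θ l z| ≤ 3 := by
  have h := abs_indirectEffect_le z.1 zero_le_one
    (sum_sq_le_of_abs_le_one (abs_iterate_le_one (A := A) hμ (extField τ θ z.1 z.2) l))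
    (sum_sq_le_of_abs_le_one (abs_iterate_le_one (A := A) hμ (extField τ θ (fun _ => -1) z.2) l))
  rw [estIE_eq]
  linarith

theorem measurable_estDE (hμ : ∀ᵐ x ∂μ, |x| ≤ 1) (t : Fin n → ℤˣ) :
    Measurable fun x : Fin n → Fin d → ℝ => estDE μ A τ θ l (t, x) :=
  measurable_directEffect t (measurable_iterate_extField hμ τ θ t l)

theorem measurable_estIE (hμ : ∀ᵐ x ∂μ, |x| ≤ 1) (t : Fin n → ℤˣ) :
    Measurable fun x : Fin n → Fin d → ℝ => estIE μ A τ θ l (t, x) :=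
  measurable_indirectEffect t (measurable_iterate_extField hμ τ θ t l)
    (measurable_iterate_extField hμ τ θ (fun _ => -1) l)

theorem abs_integral_sub_le_of_abs_sub_le {Ω : Type*} [MeasurableSpace Ω] {ρ : Measure Ω}
    [IsProbabilityMeasure ρ] {f g : Ω → ℝ} {b c R : ℝ} (hf : Measurable f) (hg : Measurable g)
    (hfb : ∀ z, |f z| ≤ b) (hgc : ∀ z, |g z| ≤ c) (h : ∀ z, |f z - g z| ≤ R) :
    |∫ z, f z ∂ρ - ∫ z, g z ∂ρ| ≤ R := by
  rw [← integral_sub (Integrable.of_bound hf.aestronglyMeasurable b (Eventually.of_forall hfb))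
    (Integrable.of_bound hg.aestronglyMeasurable c (Eventually.of_forall hgc))]
  exact abs_integral_le_of_ae_bound (Eventually.of_forall h)

variable {τ θ l}

theorem abs_integral_estDE_sub_DE_le (hμ : ∀ᵐ x ∂μ, |x| ≤ 1) (hA : A.IsSymm)
    (hA' : opNorm A ≤ 1 / 8) (hn : 0 < n) {R : ℝ} (hR0 : 0 ≤ R) (hR : meanSqError A l ≤ R ^ 2) :
    |∫ z, estDE μ A τ θ (l + 1) z ∂(simLaw n PX) - DE μ PX A τ θ| ≤ 3 * R := by
  have := isProbabilityMeasure_simLaw PX n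
  set g : (Fin n → ℤˣ) × (Fin n → Fin d → ℝ) → ℝ :=
    fun z => directEffect z.1 (gibbsMean μ A τ θ z.1 z.2) with hg
  have hgm : ∀ t, Measurable fun x => g (t, x) := fun t =>
    measurable_directEffect t (measurable_gibbsMean τ θ t)
  have hgb : ∀ z, |g z| ≤ 2 * 1 := fun z => abs_directEffect_le z.1 zero_le_one
    (sum_sq_le_of_abs_le_one (abs_gibbsMean_le_one hμ τ θ z.1 z.2))
  have hgi : ∫ z, g z ∂(simLaw n PX) = DE μ PX A τ θ := by
    rw [integral_simLaw PX hgm hgb, DE_eq_sum_directEffect]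
    exact Finset.sum_congr rfl fun t _ => by rw [← integral_directEffect_gibbsMean PX hμ]
  rw [← hgi]
  refine abs_integral_sub_le_of_abs_sub_le
    (measurable_of_measurable_section (measurable_estDE τ θ (l + 1) hμ))
    (measurable_of_measurable_section hgm) (abs_estDE_le τ θ (l + 1) hμ) hgb fun z => ?_
  rw [estDE_eq, directEffect_sub]
  refine (abs_directEffect_le z.1 hR0
    (sum_sq_iterate_sub_gibbsMean_le hμ hA hA' hn hR τ θ z.1 z.2)).trans ?_
  linarith

theorem abs_integral_estIE_sub_IE_le (hμ : ∀ᵐ x ∂μ, |x| ≤ 1) (hA : A.IsSymm)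
    (hA' : opNorm A ≤ 1 / 8) (hn : 0 < n) {R : ℝ} (hR0 : 0 ≤ R) (hR : meanSqError A l ≤ R ^ 2) :
    |∫ z, estIE μ A τ θ (l + 1) z ∂(simLaw n PX) - IE μ PX A τ θ| ≤ 3 * R := by
  have := isProbabilityMeasure_simLaw PX n
  set g : (Fin n → ℤˣ) × (Fin n → Fin d → ℝ) → ℝ :=
    fun z => indirectEffect z.1 (gibbsMean μ A τ θ z.1 z.2)
      (gibbsMean μ A τ θ (fun _ => -1) z.2) with hg
  have hgm : ∀ t, Measurable fun x => g (t, x) := fun t =>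
    measurable_indirectEffect t (measurable_gibbsMean τ θ t) (measurable_gibbsMean τ θ _)
  have hgb : ∀ z, |g z| ≤ 3 * 1 := fun z => abs_indirectEffect_le z.1 zero_le_one
    (sum_sq_le_of_abs_le_one (abs_gibbsMean_le_one hμ τ θ z.1 z.2))
    (sum_sq_le_of_abs_le_one (abs_gibbsMean_le_one hμ τ θ _ z.2))
  have hgi : ∫ z, g z ∂(simLaw n PX) = IE μ PX A τ θ := by
    rw [integral_simLaw PX hgm hgb, IE_eq_sum_indirectEffect]
    exact Finset.sum_congr rfl fun t _ => by rw [← integral_indirectEffect_gibbsMean PX hμ]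
  rw [← hgi]
  refine abs_integral_sub_le_of_abs_sub_le
    (measurable_of_measurable_section (measurable_estIE τ θ (l + 1) hμ))
    (measurable_of_measurable_section hgm) (abs_estIE_le τ θ (l + 1) hμ) hgb fun z => ?_
  rw [estIE_eq, indirectEffect_sub]
  exact abs_indirectEffect_le z.1 hR0
    (sum_sq_iterate_sub_gibbsMean_le hμ hA hA' hn hR τ θ z.1 z.2)
    (sum_sq_iterate_sub_gibbsMean_le hμ hA hA' hn hR τ θ _ z.2)

end

/-! ### Iterated limits -/

/-- The thresholds on M and n do not depend on k. The case k = 0 is excluded because there C / k is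
0 by convention. -/
theorem tendsto_limsup_limsup_zero {p : ℕ → ℕ → ℕ → ℝ≥0∞} {C : ℝ}
    (h : ∀ᶠ M in atTop, ∀ᶠ n in atTop, ∀ k, 0 < k → p k M n ≤ ENNReal.ofReal (C / k)) :
    Tendsto (fun k => limsup (fun M => limsup (fun n => p k M n) atTop) atTop) atTop (𝓝 0) := by
  have hlim : Tendsto (fun k : ℕ => ENNReal.ofReal (C / k)) atTop (𝓝 0) := by
    simpa using ENNReal.tendsto_ofReal (tendsto_const_div_atTop_nhds_zero_nat C)
  refine tendsto_of_tendsto_of_tendsto_of_le_of_le' tendsto_const_nhds hlim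
    (Eventually.of_forall fun _ => zero_le) ?_
  filter_upwards [eventually_gt_atTop 0] with k hk
  refine limsup_le_of_le (h := ?_)
  filter_upwards [h] with M hM
  refine limsup_le_of_le (h := ?_)
  filter_upwards [hM] with n hn using hn k hk

theorem eventually_meanSqError_le {A : (n : ℕ) → Matrix (Fin n) (Fin n) ℝ}
    (hA : (fun n => (A n * A n).trace) =o[atTop] (fun n : ℕ => (n : ℝ))) {δ : ℝ} (hδ : 0 < δ) :
    ∀ᶠ l in atTop, ∀ᶠ n in atTop, meanSqError (A n) l ≤ δ := by
  have h1 : Tendsto (fun l : ℕ => 32 * (1 / 2 : ℝ) ^ l) atTop (𝓝 0) := by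
    simpa using (tendsto_pow_atTop_nhds_zero_of_lt_one (by norm_num : (0 : ℝ) ≤ 1 / 2)
      (by norm_num)).const_mul 32
  have h2 : Tendsto (fun n => 2688 * ((A n * A n).trace / n)) atTop (𝓝 0) := by
    simpa using hA.tendsto_div_nhds_zero.const_mul 2688
  filter_upwards [h1.eventually_lt_const (half_pos hδ)] with l hl
  filter_upwards [h2.eventually_lt_const (half_pos hδ)] with n hn
  unfold meanSqError
  linarith

end CausalMRF

theorem mainTheorem9 :
    ∃ C₀ : ℝ, 0 < C₀ ∧
      ∀ (d : ℕ) (μ : Measure ℝ) (PX : Measure (Fin d → ℝ)) (τ : ℝ) (θ : Fin d → ℝ)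
        (A : (n : ℕ) → Matrix (Fin n) (Fin n) ℝ),
        IsProbabilityMeasure μ → (∀ᵐ y ∂μ, y ∈ Set.Icc (-1 : ℝ) 1) →
        IsProbabilityMeasure PX → (∀ᵐ x ∂PX, ∀ j, x j ∈ Set.Icc (-1 : ℝ) 1) →
        (∀ n, (A n).IsSymm) →
        BddAbove (Set.range fun n => CausalMRF.opNorm (A n)) →
        (fun n => (A n * A n).trace) =o[atTop] (fun n : ℕ => (n : ℝ)) →
        limsup (fun n => CausalMRF.opNorm (A n)) atTop ≤ C₀ →
        ∀ ε : ℝ, 0 < ε →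
          Tendsto (fun k : ℕ => limsup (fun M : ℕ => limsup (fun n : ℕ =>
              CausalMRF.replicateLaw n k PX
                {ω | ε < |CausalMRF.avgDE μ (A n) τ θ M ω - CausalMRF.DE μ PX (A n) τ θ|})
              atTop) atTop) atTop (𝓝 0) ∧
          Tendsto (fun k : ℕ => limsup (fun M : ℕ => limsup (fun n : ℕ =>
              CausalMRF.replicateLaw n k PX
                {ω | ε < |CausalMRF.avgIE μ (A n) τ θ M ω - CausalMRF.IE μ PX (A n) τ θ|})
              atTop) atTop) atTop (𝓝 0) := by
  -- Any constant below 1/8 works: a limsup strictly below 1/8 gives ‖A_n‖ ≤ 1/8 eventually.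
  refine ⟨1 / 16, by norm_num, ?_⟩
  intro d μ PX τ θ A _ hμ' _ _ hsymm hbdd htr hlim ε hε
  have hμ := CausalMRF.ae_abs_le_one hμ'
  have hop : ∀ᶠ n in atTop, CausalMRF.opNorm (A n) ≤ 1 / 8 := by
    filter_upwards [eventually_lt_of_limsup_lt (hlim.trans_lt (by norm_num : (1 / 16 : ℝ) < 1 / 8))
      hbdd.isBoundedUnder_of_range] with n hn using hn.le
  -- The bias is at most 3R = ε/4, below the ε/2 that Chebyshev's step requires.
  have hR : 0 < ε / 12 := by positivity
  have herr := CausalMRF.eventually_meanSqError_le htr (pow_pos hR 2)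
  have hev : ∀ {P : ℕ → ℕ → Prop}, (∀ l n, 0 < n → CausalMRF.opNorm (A n) ≤ 1 / 8 →
      CausalMRF.meanSqError (A n) l ≤ (ε / 12) ^ 2 → P (l + 1) n) →
      ∀ᶠ M in atTop, ∀ᶠ n in atTop, P M n := by
    intro P hP
    have : ∀ᶠ l in atTop, ∀ᶠ n in atTop, P (l + 1) n := by
      filter_upwards [herr] with l hl
      filter_upwards [hl, hop, eventually_gt_atTop 0] with n h1 h2 h3 using hP l n h3 h2 h1
    -- The error bound with index l concerns iterate l + 1, so M = l + 1 and M = 0 is discarded.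
    exact (tendsto_sub_atTop_nat 1 |>.eventually this).and (eventually_ge_atTop 1) |>.mono
      fun M hM => by simpa [Nat.sub_add_cancel hM.2] using hM.1
  refine ⟨CausalMRF.tendsto_limsup_limsup_zero (C := 4 * 3 ^ 2 / ε ^ 2) (hev ?_),
    CausalMRF.tendsto_limsup_limsup_zero (C := 4 * 3 ^ 2 / ε ^ 2) (hev ?_)⟩
  · intro l n hn h1 h2 k hk
    have := CausalMRF.isProbabilityMeasure_simLaw PX n
    refine CausalMRF.measure_pi_lt_abs_avg_sub_le _ (CausalMRF.measurable_of_measurable_section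
      (CausalMRF.measurable_estDE τ θ (l + 1) hμ)) (CausalMRF.abs_estDE_le τ θ (l + 1) hμ) hε
      ((CausalMRF.abs_integral_estDE_sub_DE_le PX hμ (hsymm n) h1 hn hR.le h2).trans_lt ?_) hk
    linarith
  · intro l n hn h1 h2 k hk
    have := CausalMRF.isProbabilityMeasure_simLaw PX n
    refine CausalMRF.measure_pi_lt_abs_avg_sub_le _ (CausalMRF.measurable_of_measurable_section
      (CausalMRF.measurable_estIE τ θ (l + 1) hμ)) (CausalMRF.abs_estIE_le τ θ (l + 1) hμ) hε
      ((CausalMRF.abs_integral_estIE_sub_IE_le PX hμ (hsymm n) h1 hn hR.le h2).trans_lt ?_) hk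
    linarith
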